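/- Let $K$ be an algebraically closed field of characteristic $0$ and let $X=\nu_3(G_{3,9})\subset\mathbb P(\bigwedge^3K^9)=\mathbb P^{83}$ be the Plücker-embedded Grassmannian of $3$-dimensional subspaces of $K^9$, i.e. the set of all points $[v_1\wedge v_2\wedge v_3]$ with $v_1,v_2,v_3\in K^9$ linearly independent. Let $X^4$, the fourth secant variety of $X$, be the Zariski closure of the union of all linear spaces spanned by four points of $X$. (a) $\dim X=18$, so the expected dimension of $X^4$ is $\min\{83,\,4\cdot 18+3\}=75$; but $\dim X^4=73$. Thus $X^4$ is defective, with defectiveness $75-73=2$. (b) For $H_1,\dots,H_4\subset K^9$ with bases $\{v_{i1},v_{i2},v_{i3}\}$, let $(v_{i1},v_{i2},v_{i3})$ denote the two-sided ideal they generate in the exterior algebra $\bigwedge(K^9)$, and let $W=\bigl[\bigcap_{i=1}^4 (v_{i1},v_{i2},v_{i3})^2\bigr]_6$ be the part of degree $6$ of the intersection of the squares of these ideals. If $e_1,\dots,e_9$ is the standard basis and $$H_1=\langle e_1,e_2,e_3\rangle,\quad H_2=\langle e_4,e_5,e_6\rangle,\quad H_3=\langle e_7,e_8,e_9\rangle,\quad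 H_4=\langle e_1+e_4+e_7,\ e_2+e_5+e_8,\ e_3+e_6+e_9\rangle,$$ then $\dim_K W=10$. (c) Four generic $3$-dimensional subspaces of $K^9$ can be carried simultaneously to the subspaces $H_1,\dots,H_4$ of (b) by an invertible linear map, and $\dim_KW=10$ for them as well. Here "generic" means: there is a nonzero polynomial $P$ in the $4\cdot 3\cdot 9$ coordinates of the vectors $v_{ij}$ such that, whenever $P(v)\neq 0$, the vectors $v_{i1},v_{i2},v_{i3}$ are linearly independent for each $i$ and the assertion holds for their spans. -/

import Mathlib

open scoped LinearAlgebra.Projectivization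

noncomputable section

namespace SecantGrassmann

/-! ### Projective varieties

Throughout, `M` is a finite dimensional vector space with a basis `b` indexed by `ι`. The polynomial
ring `MvPolynomial ι K` is the homogeneous coordinate ring of `ℙ K M`, the variable indexed by `i`
being the `i`-th coordinate with respect to `b`. -/

section Projective

variable {K : Type*} [Field K] {M : Type*} [AddCommGroup M] [Module K M]
  {ι : Type*} (b : Module.Basis ι K M)

/-- The value of `f` at a representative of the point `x`. Only its vanishing, and only for
homogeneous `f`, is used below; this does not depend on the representative. -/
def evalAt (f : MvPolynomial ι K) (x : ℙ K M) : K :=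
  MvPolynomial.eval (fun i => b.repr x.rep i) f

/-- The homogeneous forms (of any degree) that vanish at every point of `X`. -/
def vanishingForms (X : Set (ℙ K M)) : Set (MvPolynomial ι K) :=
  {f | (∃ d : ℕ, f.IsHomogeneous d) ∧ ∀ x ∈ X, evalAt b f x = 0}

/-- The Zariski closure of `X` in the projective space `ℙ K M`. -/
def zariskiClosure (X : Set (ℙ K M)) : Set (ℙ K M) :=
  {x | ∀ f ∈ vanishingForms b X, evalAt b f x = 0}

/-- The homogeneous ideal of `X`. -/
def homogeneousIdeal (X : Set (ℙ K M)) : Ideal (MvPolynomial ι K) :=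
  Ideal.span (vanishingForms b X)

/-- The closed set `X` (or, in general, the Zariski closure of `X`) is a nonempty projective
algebraic set of dimension `d`: its homogeneous coordinate ring, which is the coordinate ring of the
affine cone over it, has Krull dimension `d + 1`. For empty `X` the ring is zero and has Krull
dimension `⊥`, so that this holds for no `d`. -/
def HasDim (X : Set (ℙ K M)) (d : ℕ) : Prop :=
  ringKrullDim (MvPolynomial ι K ⧸ homogeneousIdeal b X) = (d : WithBot ℕ∞) + 1

/-- The `s`-th secant variety of `X`: the closure of the union of all linear spaces spanned by
`s` points of `X`. -/
def secantVariety (X : Set (ℙ K M)) (s : ℕ) : Set (ℙ K M) :=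
  zariskiClosure b
    {y | ∃ p : Fin s → ℙ K M, (∀ i, p i ∈ X) ∧ y.submodule ≤ ⨆ i, (p i).submodule}

/-- The expected dimension `min {N, s n + s - 1}` of the `s`-th secant variety (`s ≥ 1`) of an
`n`-dimensional variety in a projective space of dimension `N`. -/
def expectedDim (N n s : ℕ) : ℕ := min N (s * n + s - 1)

/-- `X`, in a projective space of dimension `N`, has a defective `s`-th secant variety, with
defectiveness `δ`: the dimension of that secant variety is smaller by `δ > 0` than expected. -/
def IsDefective (N : ℕ) (X : Set (ℙ K M)) (s δ : ℕ) : Prop :=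
  0 < δ ∧ ∃ n d : ℕ, HasDim b X n ∧ HasDim b (secantVariety b X s) d ∧ d + δ = expectedDim N n s

end Projective

/-! ### Grassmannians -/

section Grassmannian

variable (K : Type*) [Field K]

/-- The standard basis of `⋀ᵏ Kⁿ`: the vectors `e_{i₁} ∧ ⋯ ∧ e_{iₖ}` with `i₁ < ⋯ < iₖ`. The
corresponding coordinates are the Plücker coordinates. -/
def pluckerBasis (k n : ℕ) :
    Module.Basis (Set.powersetCard (Fin n) k) K (⋀[K]^k (Fin n → K)) :=
  (Pi.basisFun K (Fin n)).exteriorPower k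

/-- The image of the Plücker embedding, in `ℙ (⋀ᵏ Kⁿ)`, of the Grassmannian of `k`-dimensional
subspaces of `Kⁿ`: the points `[v₁ ∧ ⋯ ∧ vₖ]` with `v₁, …, vₖ` linearly independent. -/
def pluckerGrassmannian (k n : ℕ) : Set (ℙ K (⋀[K]^k (Fin n → K))) :=
  {x | ∃ v : Fin k → Fin n → K, LinearIndependent K v ∧
    x.submodule = Submodule.span K {exteriorPower.ιMulti K k v}}

end Grassmannian

/-! ### Squares of ideals in the exterior algebra -/

section Exterior

variable {K : Type*} [Field K] {V : Type*} [AddCommGroup V] [Module K V]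

/-- The two-sided ideal `(v₁, …, vₖ)` of the exterior algebra of `V`, as a `K`-subspace: the
span of the products `a * vᵢ * b`. -/
def extIdeal {k : ℕ} (v : Fin k → V) : Submodule K (ExteriorAlgebra K V) :=
  ⊤ * Submodule.span K (Set.range fun i => ExteriorAlgebra.ι K (v i)) * ⊤

/-- The degree `d` part of `I₁² ∩ ⋯ ∩ I_s²`, where `I_j` is the ideal of the exterior algebra
generated by `v j 0, …, v j (k - 1)`. -/
def squaresPart {s k : ℕ} (v : Fin s → Fin k → V) (d : ℕ) : Submodule K (ExteriorAlgebra K V) :=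
  (⨅ j, extIdeal (K := K) (v j) ^ 2) ⊓ ⋀[K]^d V

variable (K)

/-- The standard basis vector `e_{i+1}` of `K⁹` (`i = 0, …, 8`). -/
def e (i : Fin 9) : Fin 9 → K := Pi.single i 1

/-- Bases of `⟨e₁, e₂, e₃⟩`, `⟨e₄, e₅, e₆⟩`, `⟨e₇, e₈, e₉⟩` and
`⟨e₁ + e₄ + e₇, e₂ + e₅ + e₈, e₃ + e₆ + e₉⟩`. -/
def normalForm : Fin 4 → Fin 3 → Fin 9 → K :=
  ![![e K 0, e K 1, e K 2], ![e K 3, e K 4, e K 5], ![e K 6, e K 7, e K 8],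
    ![e K 0 + e K 3 + e K 6, e K 1 + e K 4 + e K 7, e K 2 + e K 5 + e K 8]]

end Exterior

end SecantGrassmann

end

/-!
The dimension of a projective set is one less than the Krull dimension of its homogeneous coordinate
ring. If the cone over the set is parametrised by polynomials, this ring is the algebra which they
generate (`IsParametrizedBy.homogeneousIdeal_eq`), its Krull dimension is its transcendence degree,
and in characteristic zero that is the generic rank of the Jacobian matrix
(`IsParametrizedBy.hasDim`). The cones over the Grassmannian and over its secant varieties are
parametrised by sums of products `v₁ ∧ v₂ ∧ v₃`, and the image of the differential is the sum of the
tangent spaces `⋀²H ∧ V` at the summands (`rank_jacobian_pluckerSum`): this is Terracini's lemma.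

One tangent space has dimension `19`. Four subspaces, any three of which span `K⁹`, are
carried to the normal form by decomposing the vectors of the fourth one along the other three
(`exists_linearEquiv_normalForm`), so the sum of four tangent spaces need only be computed there.
In normal form the subspaces are `K³ ⊗ c` in `K³ ⊗ K³`, with `c` one of `(1,0,0)`, `(0,1,0)`,
`(0,0,1)`, `(1,1,1)`. Taking the determinant of the matrix of linear forms that three vectors of
`K³ ⊗ K³` define is a map `⋀³(K³ ⊗ K³) → S³(K³)` (`cubicMap`) onto a space of dimension `10`. It
vanishes on all four tangent spaces. Modulo these, `⋀³` is spanned by the products with one vector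
`e_{k,f(k)}` from each block, which the fourth tangent space makes symmetric in `f`, so that ten of
them suffice. Hence the sum of the tangent spaces is the kernel of `cubicMap`
(`sumTangentSpace_eq_ker_cubicMap`), of dimension `84 - 10 = 74`, and the secant variety has
dimension `73`.

The space `W` is dual to the quotient of `⋀³` by the sum of the tangent spaces
(`finrank_squaresPart_normalForm`). Under the perfect pairing of `⋀⁶` with `⋀³`, the square of the
ideal of `H` annihilates the tangent space at `H`. Conversely, for a point `q` of the plane, the
linear forms in `K³` that vanish at `q` give a six-dimensional subspace of `K³ ⊗ K³` that meets each
of the four subspaces in a plane. The product of a basis of it (`kerVec`) therefore lies in `W`, and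
it pairs with `z` to a nonzero multiple of the value of the cubic form `cubicMap z` at `q`. An
element of `⋀³` orthogonal to `W` is thus in the kernel of `cubicMap`.
-/

noncomputable section

namespace SecantGrassmann

/-! ### Krull dimension and transcendence degree -/

/-- Incomparability gives one inequality, lying over and going up the other. -/
theorem ringKrullDim_eq_of_isIntegral {R S : Type*} [CommRing R] [CommRing S] [Algebra R S]
    [IsDomain S] [Algebra.IsIntegral R S] (hinj : Function.Injective (algebraMap R S)) :
    ringKrullDim S = ringKrullDim R := by
  apply le_antisymm
  · refine Order.krullDim_le_of_strictMono (PrimeSpectrum.comap (algebraMap R S)) ?_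
    intro p q hpq
    exact Ideal.IsIntegral.comap_lt_comap hpq
  · refine iSup_le fun l => ?_
    have : FaithfulSMul R S := (faithfulSMul_iff_algebraMap_injective R S).2 hinj
    obtain ⟨P, hP, hP'⟩ := Ideal.exists_ideal_over_prime_of_isIntegral_of_isDomain (S := S)
      l.head.asIdeal (by rw [(RingHom.injective_iff_ker_eq_bot _).1 hinj]; exact bot_le)
    have : P.LiesOver l.head.asIdeal := ⟨hP'.symm⟩
    obtain ⟨L, hL, -⟩ := Ideal.exists_ltSeries_of_hasGoingUp (S := S) l P
    rw [← hL]
    exact Order.LTSeries.length_le_krullDim L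

/-- By Noether normalization the ring is integral over a polynomial ring in `n` variables. -/
theorem ringKrullDim_eq_of_trdeg_eq (K : Type*) {R : Type*} [Field K] [CommRing R] [IsDomain R]
    [Algebra K R] [Algebra.FiniteType K R] {n : ℕ} (h : Algebra.trdeg K R = n) :
    ringKrullDim R = n := by
  obtain ⟨s, g, hg, hint⟩ := exists_integral_inj_algHom_of_fg K R
  algebraize [g.toRingHom]
  have hinj : Function.Injective (algebraMap (MvPolynomial (Fin s) K) R) := hg
  have : Algebra.IsIntegral (MvPolynomial (Fin s) K) R := ⟨hint⟩
  rw [ringKrullDim_eq_of_isIntegral hinj, MvPolynomial.ringKrullDim_of_isNoetherianRing,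
    ringKrullDim_eq_zero_of_field]
  have : FaithfulSMul (MvPolynomial (Fin s) K) R :=
    (faithfulSMul_iff_algebraMap_injective _ _).2 hinj
  have h2 := (IsTranscendenceBasis.algebraMap_comp (A := R)
    (IsTranscendenceBasis.mvPolynomial (Fin s) K)).lift_cardinalMk_eq_trdeg
  rw [h] at h2
  simp only [Cardinal.mk_fin, Cardinal.lift_natCast, Nat.cast_inj] at h2
  simp [h2]

/-! ### The Jacobian criterion in characteristic zero -/

/-- A derivation of a domain of characteristic zero that vanishes on a subalgebra vanishes on
everything algebraic over it: differentiate a relation of minimal degree. -/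
theorem derivation_eq_zero_of_isAlgebraic {K A : Type*} [Field K] [CharZero K] [CommRing A]
    [IsDomain A] [Algebra K A] (S : Subalgebra K A) (δ : Derivation K A A)
    (hδ : ∀ a ∈ S, δ a = 0) {a : A} (ha : IsAlgebraic S a) : δ a = 0 := by
  classical
  let δ' : Derivation S A A := Derivation.mk'
    { toFun := δ
      map_add' := fun x y => map_add δ x y
      map_smul' := fun s x => by
        simp [Algebra.smul_def, hδ _ s.2] } (fun x y => by simp)
  have hex : ∃ n : ℕ, ∃ p : Polynomial S, p ≠ 0 ∧ Polynomial.aeval a p = 0 ∧ p.natDegree = n := by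
    obtain ⟨p, hp, hp'⟩ := ha
    exact ⟨_, p, hp, hp', rfl⟩
  obtain ⟨p, hp, hpa, hpn⟩ := Nat.find_spec hex
  have : CharZero A := charZero_of_injective_algebraMap (algebraMap K A).injective
  have : CharZero S := charZero_of_injective_algebraMap (algebraMap K S).injective
  have h0 : Polynomial.aeval a p.derivative • δ' a = 0 := by
    rw [← Derivation.map_aeval, hpa, map_zero]
  rw [smul_eq_mul, mul_eq_zero] at h0
  rcases h0 with h0 | h0
  · exfalso
    have hdeg : p.natDegree ≠ 0 := by
      intro hd
      rw [Polynomial.eq_C_of_natDegree_eq_zero hd] at hpa hp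
      simp only [Polynomial.aeval_C] at hpa
      have : p.coeff 0 = 0 := Subtype.ext hpa
      simp [this] at hp
    have hlt := Polynomial.natDegree_derivative_lt hdeg
    refine Nat.find_min hex (hpn ▸ hlt) ⟨_, ?_, h0, rfl⟩
    intro hd
    exact hdeg (Polynomial.derivative_eq_zero.1 hd)
  · exact h0

section Jacobian

open MvPolynomial

variable {K : Type*} [Field K] [CharZero K] {τ : Type}

theorem exists_eval_ne_zero {P : MvPolynomial τ K} (hP : P ≠ 0) : ∃ t, eval t P ≠ 0 := by
  by_contra! h
  exact hP (MvPolynomial.funext fun t => by simp [h t])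

variable [Fintype τ]

/-- The Jacobian matrix of a family of polynomials at a point. -/
def jacobian {ι : Type*} (θ : ι → MvPolynomial τ K) (t : τ → K) : Matrix ι τ K :=
  Matrix.of fun i s => eval t (pderiv s (θ i))

/-- Algebraically independent polynomials have linearly independent gradients at a general point:
after completing them by variables to a transcendence basis the Jacobian matrix is square, and
it is nonsingular because a derivation killing a transcendence basis is zero. -/
theorem exists_linearIndependent_jacobian {κ : Type} {y : κ → MvPolynomial τ K}
    (hy : AlgebraicIndependent K y) {P : MvPolynomial τ K} (hP : P ≠ 0) :
    ∃ t, eval t P ≠ 0 ∧ LinearIndependent K (jacobian y t).row := by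
  classical
  have : Algebra.IsAlgebraic
      (Algebra.adjoin K (Set.range y ∪ Set.range (X : τ → MvPolynomial τ K)))
      (MvPolynomial τ K) := by
    refine ⟨fun a => ?_⟩
    have ha : a ∈ Algebra.adjoin K (Set.range y ∪ Set.range (X : τ → MvPolynomial τ K)) :=
      Algebra.adjoin_mono Set.subset_union_right (by rw [adjoin_range_X]; trivial)
    exact isAlgebraic_algebraMap (⟨a, ha⟩ : Algebra.adjoin K _)
  obtain ⟨u, hu1, -, hu⟩ := exists_isTranscendenceBasis_between (R := K) (Set.range y)
    (Set.range y ∪ Set.range (X : τ → MvPolynomial τ K)) Set.subset_union_left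
    hy.to_subtype_range
  have hcard := hu.lift_cardinalMk_eq (IsTranscendenceBasis.mvPolynomial τ K)
  obtain ⟨eqv⟩ := Cardinal.lift_mk_eq'.1 hcard
  let N : Matrix τ τ (MvPolynomial τ K) :=
    Matrix.of fun i s => pderiv s (eqv.symm i : MvPolynomial τ K)
  have hdet : N.det ≠ 0 := by
    intro h0
    obtain ⟨w, hw, hNw⟩ := Matrix.exists_mulVec_eq_zero_iff.2 h0
    apply hw
    have hz : ∀ f : MvPolynomial τ K, mkDerivation K w f = ∑ s, pderiv s f * w s := by
      intro f
      have : (mkDerivation K w : Derivation K (MvPolynomial τ K) (MvPolynomial τ K)) =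
          ∑ s, w s • pderiv s := by
        apply MvPolynomial.derivation_ext
        intro i
        rw [mkDerivation_X, ← Derivation.coeFnAddMonoidHom_apply, map_sum, Finset.sum_apply]
        simp [pderiv_X, Pi.single_apply, Derivation.coeFnAddMonoidHom_apply]
      rw [this, ← Derivation.coeFnAddMonoidHom_apply, map_sum, Finset.sum_apply]
      simp [Derivation.coeFnAddMonoidHom_apply, mul_comm]
    have hker : ∀ a ∈ Algebra.adjoin K u, mkDerivation K w a = 0 := by
      intro a ha
      induction ha using Algebra.adjoin_induction with
      | mem x hx =>
        rw [hz]
        have := congrFun hNw (eqv ⟨x, hx⟩)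
        simpa [N, Matrix.mulVec, dotProduct] using this
      | algebraMap r => simp
      | add x y _ _ h1 h2 => simp [h1, h2]
      | mul x y _ _ h1 h2 => simp [h1, h2]
    ext1 s
    have halg : IsAlgebraic (Algebra.adjoin K u) (X s : MvPolynomial τ K) := by
      have := hu.isAlgebraic
      rw [Subtype.range_coe] at this
      exact this.isAlgebraic _
    simpa using derivation_eq_zero_of_isAlgebraic _ (mkDerivation K w) hker halg
  obtain ⟨t, ht⟩ := exists_eval_ne_zero (mul_ne_zero hP hdet)
  rw [map_mul] at ht
  refine ⟨t, left_ne_zero_of_mul ht, ?_⟩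
  have h2 : (N.map (eval t)).det ≠ 0 := by
    rw [← RingHom.mapMatrix_apply, ← RingHom.map_det]
    exact right_ne_zero_of_mul ht
  have h3 := Matrix.linearIndependent_rows_of_det_ne_zero h2
  have h4 := h3.comp (fun k : κ => eqv ⟨y k, hu1 ⟨k, rfl⟩⟩) (by
    intro k l hkl
    exact hy.injective (by simpa using hkl))
  have h5 : (jacobian y t).row =
      (fun i => (N.map (eval t)) i) ∘ fun k : κ => eqv ⟨y k, hu1 ⟨k, rfl⟩⟩ := by
    funext k
    ext s
    simp [jacobian, N, Matrix.row]
  rw [h5]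
  exact h4

/-- Polynomials with linearly independent gradients at one point are algebraically independent:
in a relation `F` of minimal degree, every partial derivative of `F` would be a relation too. -/
theorem algebraicIndependent_of_jacobian {κ : Type} [Fintype κ] {y : κ → MvPolynomial τ K}
    {t : τ → K} (h : LinearIndependent K (jacobian y t).row) : AlgebraicIndependent K y := by
  classical
  -- a right inverse `B` of the Jacobian matrix at `t`
  obtain ⟨B, hB⟩ : ∃ B : Matrix τ κ K, jacobian y t * B = 1 := by
    have h1 : Function.Injective (jacobian y t).vecMul := Matrix.vecMul_injective_iff.2 h
    obtain ⟨g, hg⟩ := LinearMap.exists_leftInverse_of_injective (jacobian y t).vecMulLinear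
      (LinearMap.ker_eq_bot.2 h1)
    refine ⟨LinearMap.toMatrixRight' g, ?_⟩
    apply Matrix.toLinearMapRight'.injective
    rw [Matrix.toLinearMapRight'_mul, Matrix.toLinearMapRight'_one]
    refine Eq.trans ?_ hg
    congr 1
    exact Matrix.toLinearMapRight'.apply_symm_apply g
  let J : Matrix κ τ (MvPolynomial τ K) := Matrix.of fun i s => pderiv s (y i)
  let B' : Matrix τ κ (MvPolynomial τ K) := B.map C
  have hdet : (J * B').det ≠ 0 := by
    intro h0
    have h1 := congrArg (eval t) h0
    rw [RingHom.map_det, RingHom.mapMatrix_apply, Matrix.map_mul, map_zero] at h1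
    have h2 : J.map (eval t) = jacobian y t := by ext; simp [J, jacobian]
    have h3 : B'.map (eval t) = B := by ext; simp [B']
    rw [h2, h3, hB, Matrix.det_one] at h1
    exact one_ne_zero h1
  have hlin : ∀ a : κ → MvPolynomial τ K, Matrix.vecMul a J = 0 → a = 0 := by
    intro a ha
    refine Matrix.eq_zero_of_vecMul_eq_zero hdet ?_
    rw [← Matrix.vecMul_vecMul, ha, Matrix.zero_vecMul]
  rw [algebraicIndependent_iff]
  have hchain : ∀ (F : MvPolynomial κ K) (s : τ),
      pderiv s (aeval y F) = ∑ i, aeval y (pderiv i F) * pderiv s (y i) := by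
    intro F s
    induction F using MvPolynomial.induction_on with
    | C a => simp
    | add p q hp hq => simp only [map_add, hp, hq, add_mul, Finset.sum_add_distrib]
    | mul_X p i hp =>
      simp only [map_mul, aeval_X, Derivation.leibniz, smul_eq_mul, hp, pderiv_X, map_add,
        add_mul, Finset.sum_add_distrib, Finset.mul_sum]
      congr 1
      · simp [Pi.single_apply]
      · exact Finset.sum_congr rfl fun j _ => by ring
  suffices H : ∀ n, ∀ F : MvPolynomial κ K, F.totalDegree ≤ n → aeval y F = 0 → F = 0 from
    fun F hF => H _ F le_rfl hF
  intro n
  induction n with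
  | zero =>
    intro F hn hF
    rw [totalDegree_eq_zero_iff_eq_C.1 (Nat.le_zero.1 hn)] at hF ⊢
    simpa using hF
  | succ n ih =>
    intro F hn hF
    have hcoeff : ∀ i m, coeff m (pderiv i F) = coeff (m + Finsupp.single i 1) F * (m i + 1) := by
      intro i m
      rw [coeff_pderiv]
    have hd : ∀ i, pderiv i F = 0 := by
      intro i
      apply ih
      · refine Finset.sup_le fun m hm => ?_
        rw [mem_support_iff, hcoeff] at hm
        have := (le_totalDegree (mem_support_iff.2 (left_ne_zero_of_mul hm))).trans hn
        rw [Finsupp.sum_add_index' (by simp) (by simp)] at this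
        simpa using this
      · refine congrFun (hlin (fun i => aeval y (pderiv i F)) ?_) i
        ext1 s
        have := hchain F s
        rw [hF, map_zero] at this
        simpa [Matrix.vecMul, dotProduct, J] using this.symm
    have hC : F = C (coeff 0 F) := by
      ext m
      rw [coeff_C]
      split_ifs with hm
      · rw [hm]
      · obtain ⟨i, hi⟩ : ∃ i, m i ≠ 0 := by
          by_contra! h0
          exact hm (Finsupp.ext h0).symm
        have h1 := hcoeff i (m - Finsupp.single i 1)
        rw [hd, coeff_zero, tsub_add_cancel_of_le
          (Finsupp.single_le_iff.2 (Nat.one_le_iff_ne_zero.2 hi))] at h1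
        exact (mul_eq_zero.1 h1.symm).resolve_right (Nat.cast_add_one_ne_zero _)
    rw [hC] at hF ⊢
    simpa using hF

end Jacobian

/-! ### Parametrised projective sets -/

section Param

open MvPolynomial

variable {K : Type*} [Field K] [CharZero K] {τ : Type} [Fintype τ] {ι : Type} [Fintype ι]

/-- The algebra generated by a family of polynomials has transcendence degree the generic rank of
the Jacobian matrix. -/
theorem trdeg_adjoin_eq_of_rank_jacobian {θ : ι → MvPolynomial τ K} {P : MvPolynomial τ K}
    (hP : P ≠ 0) {r : ℕ} (hle : ∀ t, eval t P ≠ 0 → (jacobian θ t).rank ≤ r)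
    (hge : ∃ t, r ≤ (jacobian θ t).rank) :
    Algebra.trdeg K (Algebra.adjoin K (Set.range θ)) = r := by
  classical
  let S := Algebra.adjoin K (Set.range θ)
  let θ' : ι → S := fun i => ⟨θ i, Algebra.subset_adjoin ⟨i, rfl⟩⟩
  have hinj : Function.Injective S.val := Subtype.val_injective
  have htop : Algebra.adjoin K (Set.range θ') = ⊤ := by
    apply Subalgebra.map_injective hinj
    rw [AlgHom.map_adjoin, ← Set.range_comp, Algebra.map_top, Subalgebra.range_val]
    rfl
  have : Algebra.IsAlgebraic (Algebra.adjoin K (Set.range θ')) S := by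
    refine ⟨fun a => ?_⟩
    have ha : a ∈ Algebra.adjoin K (Set.range θ') := by rw [htop]; trivial
    exact isAlgebraic_algebraMap (⟨a, ha⟩ : Algebra.adjoin K (Set.range θ'))
  apply le_antisymm
  · obtain ⟨u, hu, hub⟩ := exists_isTranscendenceBasis_subset (R := K) (Set.range θ')
    choose f hf using fun a : u => hu a.2
    have h1 : AlgebraicIndependent K (fun a : u => θ (f a)) := by
      have h2 := hub.1.map' (f := S.val) hinj
      have h3 : (S.val ∘ fun a : u => (a : S)) = fun a : u => θ (f a) := by
        funext a
        rw [Function.comp_apply, ← hf a]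
        rfl
      rwa [h3] at h2
    have hfinj : Function.Injective f := fun a b hab => Subtype.ext (by rw [← hf, ← hf, hab])
    have h4 : AlgebraicIndependent K (fun i : Set.range f => θ i) := by
      let e := Equiv.ofInjective f hfinj
      have := h1.comp e.symm e.symm.injective
      convert this using 1
      funext i
      obtain ⟨a, rfl⟩ := e.surjective i
      simp [e]
    obtain ⟨t, ht, hli⟩ := exists_linearIndependent_jacobian h4 hP
    have h5 : Fintype.card (Set.range f) ≤ r := by
      refine le_trans ?_ (hle t ht)
      rw [Matrix.rank_eq_finrank_span_row, ← finrank_span_eq_card hli]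
      apply Submodule.finrank_mono
      apply Submodule.span_mono
      rintro _ ⟨i, rfl⟩
      exact ⟨i, rfl⟩
    have : Fintype u := Fintype.ofInjective f hfinj
    rw [← hub.cardinalMk_eq_trdeg, Cardinal.mk_fintype]
    have h6 := Fintype.card_congr (Equiv.ofInjective f hfinj)
    exact_mod_cast h6.trans_le (by convert h5)
  · obtain ⟨t, ht⟩ := hge
    rw [Matrix.rank_eq_finrank_span_row] at ht
    obtain ⟨f, hf, hli⟩ : ∃ f : Fin r → ι, Function.Injective f ∧
        LinearIndependent K (fun k => (jacobian θ t).row (f k)) := by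
      obtain ⟨s, hs1, hs2, hs3⟩ := exists_linearIndependent K (Set.range (jacobian θ t).row)
      have : Fintype s := (Set.Finite.subset (Set.finite_range _) hs1).fintype
      have hcard : r ≤ Fintype.card s := by
        rw [← hs2, ← Subtype.range_coe (s := s), finrank_span_eq_card hs3] at ht
        exact ht
      choose g hg using fun a : s => hs1 a.2
      let e : Fin r ↪ s := (Fin.castLEEmb hcard).trans (Fintype.equivFin s).symm.toEmbedding
      have h0 : LinearIndependent K (fun k => (jacobian θ t).row (g (e k))) := by
        have h1 : (fun k => (jacobian θ t).row (g (e k))) = Subtype.val ∘ e :=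
          funext fun k => hg _
        rw [h1]
        exact hs3.comp e e.injective
      exact ⟨fun k => g (e k), fun k l hkl => h0.injective (by simp only [hkl]), h0⟩
    have h1 : AlgebraicIndependent K (fun k => θ (f k)) := by
      apply algebraicIndependent_of_jacobian (t := t)
      exact hli
    have h2 : AlgebraicIndependent K (fun k => θ' (f k)) :=
      AlgebraicIndependent.of_comp S.val h1
    have := h2.lift_cardinalMk_le_trdeg
    simpa using this

variable {M : Type*} [AddCommGroup M] [Module K M] (b : Module.Basis ι K M)

omit [CharZero K] [Fintype ι] in
theorem vanishingForms_zariskiClosure (X : Set (ℙ K M)) :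
    vanishingForms b (zariskiClosure b X) = vanishingForms b X := by
  ext f
  constructor
  · rintro ⟨hf, h⟩
    exact ⟨hf, fun x hx => h x fun g hg => hg.2 x hx⟩
  · rintro ⟨hf, h⟩
    exact ⟨hf, fun x hx => hx f ⟨hf, h⟩⟩

/-- The cone over `X` is parametrised, up to closure, by the polynomials `θ i`, homogeneous of the
same positive degree: it consists of values of `θ`, and contains the values of `θ` at all
points where `P` does not vanish. -/
structure IsParametrizedBy (X : Set (ℙ K M)) (θ : ι → MvPolynomial τ K) (P : MvPolynomial τ K) :
    Prop where
  ne_zero : P ≠ 0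
  exists_homogeneous : ∃ m, 0 < m ∧ ∀ i, (θ i).IsHomogeneous m
  exists_ne_zero : ∃ i, θ i ≠ 0
  mem : ∀ t, eval t P ≠ 0 → ∀ (v : M) (hv : v ≠ 0), (∀ i, b.repr v i = eval t (θ i)) →
    Projectivization.mk K v hv ∈ X
  exists_eq : ∀ x ∈ X, ∃ t, ∀ i, b.repr x.rep i = eval t (θ i)

omit [CharZero K] [Fintype ι] in
theorem eval_smul_of_isHomogeneous {f : MvPolynomial ι K} {d : ℕ} (hf : f.IsHomogeneous d) (c : K)
    (v : ι → K) : eval (fun i => c * v i) f = c ^ d * eval v f := by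
  rw [eval_eq, eval_eq, Finset.mul_sum]
  refine Finset.sum_congr rfl fun m hm => ?_
  have := hf (mem_support_iff.1 hm)
  simp only [mul_pow, Finset.prod_mul_distrib, Finset.prod_pow_eq_pow_sum]
  rw [← this, Finsupp.weight_apply, Finsupp.sum]
  simp only [Pi.one_apply, smul_eq_mul, mul_one]
  ring

variable {b}

omit [Fintype τ] in
/-- A homogeneous form vanishes on `X` if and only if it is a relation between the
parametrising polynomials. -/
theorem IsParametrizedBy.mem_vanishingForms_iff {X : Set (ℙ K M)} {θ : ι → MvPolynomial τ K}
    {P : MvPolynomial τ K} (h : IsParametrizedBy b X θ P) {f : MvPolynomial ι K} {d : ℕ}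
    (hf : f.IsHomogeneous d) : f ∈ vanishingForms b X ↔ aeval θ f = 0 := by
  have hev : ∀ t, eval t (aeval θ f) = eval (fun i => eval t (θ i)) f := by
    intro t
    rw [← aeval_eq_eval, ← aeval_eq_eval, ← AlgHom.comp_apply, comp_aeval]
  constructor
  · rintro ⟨-, hX⟩
    obtain ⟨i₀, hi₀⟩ := h.exists_ne_zero
    -- the factor `θ i₀` excludes the parameters at which all coordinates vanish
    suffices H : P * θ i₀ * aeval θ f = 0 from
      (mul_eq_zero.1 H).resolve_left (mul_ne_zero h.ne_zero hi₀)
    refine MvPolynomial.funext fun t => ?_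
    rw [map_mul, map_mul, map_zero]
    by_cases ht : eval t P = 0
    · simp [ht]
    by_cases ht' : eval t (θ i₀) = 0
    · simp [ht']
    rw [hev]
    let v : M := b.equivFun.symm fun i => eval t (θ i)
    have hv : ∀ i, b.repr v i = eval t (θ i) := fun i => by
      rw [← b.equivFun_apply, LinearEquiv.apply_symm_apply]
    have hv0 : v ≠ 0 := by
      intro h0
      apply ht'
      rw [← hv, h0, map_zero, Finsupp.zero_apply]
    have h1 := hX _ (h.mem t ht v hv0 hv)
    obtain ⟨c, hc⟩ := Projectivization.exists_smul_eq_mk_rep K v hv0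
    rw [evalAt, ← hc] at h1
    have h2 : (fun i => b.repr (c • v) i) = fun i => (c : K) * eval t (θ i) := by
      funext i
      rw [Units.smul_def, map_smul, Finsupp.smul_apply, hv, smul_eq_mul]
    rw [h2, eval_smul_of_isHomogeneous hf] at h1
    rw [(mul_eq_zero.1 h1).resolve_left (pow_ne_zero _ c.ne_zero), mul_zero]
  · intro h0
    refine ⟨⟨d, hf⟩, fun x hx => ?_⟩
    obtain ⟨t, ht⟩ := h.exists_eq x hx
    rw [evalAt]
    simp only [ht]
    rw [← hev, h0, map_zero]

omit [Fintype τ] in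
theorem IsParametrizedBy.homogeneousIdeal_eq {X : Set (ℙ K M)} {θ : ι → MvPolynomial τ K}
    {P : MvPolynomial τ K} (h : IsParametrizedBy b X θ P) :
    homogeneousIdeal b X = RingHom.ker (aeval θ : MvPolynomial ι K →ₐ[K] MvPolynomial τ K) := by
  apply le_antisymm
  · refine Ideal.span_le.2 fun f hf => ?_
    obtain ⟨d, hd⟩ := hf.1
    exact (h.mem_vanishingForms_iff hd).1 hf
  · intro f hf
    obtain ⟨m, hm, hθ⟩ := h.exists_homogeneous
    have hcomp : ∀ (d : ℕ) (g : MvPolynomial ι K), g.IsHomogeneous d →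
        (aeval θ g).IsHomogeneous (m * d) := fun d g hg => hg.aeval _ hθ
    have hsum : aeval θ f = ∑ d ∈ Finset.range (f.totalDegree + 1),
        aeval θ (homogeneousComponent d f) := by
      rw [← map_sum, sum_homogeneousComponent]
    have hzero : ∀ d, aeval θ (homogeneousComponent d f) = 0 := by
      intro d
      by_cases hd : d ∈ Finset.range (f.totalDegree + 1)
      · -- as `m > 0`, the degrees `m * d` of the summands are distinct
        have h1 := congrArg (homogeneousComponent (m * d)) hsum
        rw [RingHom.mem_ker.1 hf, map_zero, map_sum, Finset.sum_eq_single_of_mem d hd,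
          homogeneousComponent_of_mem (hcomp d _ (homogeneousComponent_isHomogeneous _ _)),
          if_pos rfl] at h1
        · exact h1.symm
        · intro e _ hed
          rw [homogeneousComponent_of_mem (hcomp e _ (homogeneousComponent_isHomogeneous _ _)),
            if_neg]
          intro h2
          exact hed (Nat.eq_of_mul_eq_mul_left hm h2).symm
      · rw [homogeneousComponent_eq_zero, map_zero]
        simpa using hd
    rw [← sum_homogeneousComponent f]
    refine Ideal.sum_mem _ fun d _ => Ideal.subset_span ?_
    exact (h.mem_vanishingForms_iff (homogeneousComponent_isHomogeneous _ _)).2 (hzero d)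

omit [CharZero K] [Fintype ι] in
theorem homogeneousIdeal_zariskiClosure (X : Set (ℙ K M)) :
    homogeneousIdeal b (zariskiClosure b X) = homogeneousIdeal b X := by
  rw [homogeneousIdeal, homogeneousIdeal, vanishingForms_zariskiClosure]

/-- The dimension of the cone over a parametrised projective set is the generic rank of the
differential of the parametrisation. -/
theorem IsParametrizedBy.hasDim {X : Set (ℙ K M)} {θ : ι → MvPolynomial τ K}
    {P : MvPolynomial τ K} (h : IsParametrizedBy b X θ P) {d : ℕ}
    (hle : ∀ t, eval t P ≠ 0 → (jacobian θ t).rank ≤ d + 1)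
    (hge : ∃ t, d + 1 ≤ (jacobian θ t).rank) : HasDim b X d := by
  have h1 := trdeg_adjoin_eq_of_rank_jacobian h.ne_zero hle hge
  have : Algebra.FiniteType K (Algebra.adjoin K (Set.range θ)) := by
    rw [← Subalgebra.fg_iff_finiteType]
    exact ⟨(Set.finite_range θ).toFinset, by simp⟩
  have h2 := ringKrullDim_eq_of_trdeg_eq K h1
  have hker : RingHom.ker (aeval θ : MvPolynomial ι K →ₐ[K] MvPolynomial τ K) =
      RingHom.ker (aeval θ : MvPolynomial ι K →ₐ[K] MvPolynomial τ K).rangeRestrict :=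
    (RingHom.ker_rangeRestrict (aeval θ : MvPolynomial ι K →ₐ[K] MvPolynomial τ K).toRingHom).symm
  have e : (MvPolynomial ι K ⧸ homogeneousIdeal b X) ≃+* Algebra.adjoin K (Set.range θ) :=
    (Ideal.quotEquivOfEq (h.homogeneousIdeal_eq.trans hker)).trans
      ((Ideal.quotientKerAlgEquivOfSurjective
        (aeval θ : MvPolynomial ι K →ₐ[K] _).rangeRestrict_surjective).toRingEquiv.trans
        (Subalgebra.equivOfEq _ _ (Algebra.adjoin_range_eq_range_aeval K θ).symm).toRingEquiv)
  rw [HasDim, ringKrullDim_eq_of_ringEquiv e, h2]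
  exact_mod_cast rfl

end Param

/-! ### Tangent spaces of the Grassmannian of 3-dimensional subspaces -/

section Tangent

variable {K : Type*} [Field K] {V : Type*} [AddCommGroup V] [Module K V]

/-- The affine tangent space `⋀²H ∧ V` at `[⋀³H]` to the cone over the Grassmannian of
`3`-dimensional subspaces: the span of the products of three vectors two of which lie in `H`. -/
def tangentSpace (H : Submodule K V) : Submodule K (⋀[K]^3 V) :=
  Submodule.span K
    {x | ∃ u : Fin 3 → V, (∃ i j, i ≠ j ∧ u i ∈ H ∧ u j ∈ H) ∧ x = exteriorPower.ιMulti K 3 u}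

theorem ιMulti_mem_tangentSpace {H : Submodule K V} {u : Fin 3 → V} {i j : Fin 3} (hij : i ≠ j)
    (hi : u i ∈ H) (hj : u j ∈ H) : exteriorPower.ιMulti K 3 u ∈ tangentSpace H :=
  Submodule.subset_span ⟨u, ⟨i, j, hij, hi, hj⟩, rfl⟩

/-- The differential of `v ↦ v₁ ∧ v₂ ∧ v₃`. -/
def wedgeDeriv (v : Fin 3 → V) : (Fin 3 → V) →ₗ[K] ⋀[K]^3 V :=
  (exteriorPower.ιMulti K 3).toMultilinearMap.linearDeriv v

theorem wedgeDeriv_apply (v w : Fin 3 → V) : wedgeDeriv (K := K) v w =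
    ∑ a, exteriorPower.ιMulti K 3 (Function.update v a (w a)) := by
  simp [wedgeDeriv, MultilinearMap.linearDeriv_apply]

theorem wedgeDeriv_single (v : Fin 3 → V) (a : Fin 3) (x : V) :
    wedgeDeriv (K := K) v (Pi.single a x) =
      exteriorPower.ιMulti K 3 (Function.update v a x) := by
  rw [wedgeDeriv_apply, Finset.sum_eq_single a]
  · rw [Pi.single_eq_same]
  · intro b _ hb
    rw [Pi.single_eq_of_ne hb]
    exact AlternatingMap.map_update_zero _ _ _
  · simp

/-- The image of the differential at `v` is the tangent space at the span of `v`; the vectors need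
not be independent. -/
theorem range_wedgeDeriv (v : Fin 3 → V) :
    LinearMap.range (wedgeDeriv (K := K) v) = tangentSpace (Submodule.span K (Set.range v)) := by
  apply le_antisymm
  · rintro _ ⟨w, rfl⟩
    rw [wedgeDeriv_apply]
    refine Submodule.sum_mem _ fun a _ => ?_
    obtain ⟨i, j, hij, hi, hj⟩ : ∃ i j : Fin 3, i ≠ j ∧ i ≠ a ∧ j ≠ a := by
      revert a; decide
    refine ιMulti_mem_tangentSpace hij ?_ ?_
    · rw [Function.update_of_ne hi]
      exact Submodule.subset_span ⟨i, rfl⟩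
    · rw [Function.update_of_ne hj]
      exact Submodule.subset_span ⟨j, rfl⟩
  · refine Submodule.span_le.2 ?_
    rintro _ ⟨u, ⟨i, j, hij, hi, hj⟩, rfl⟩
    have key : ∀ x ∈ Submodule.span K (Set.range v), ∀ y ∈ Submodule.span K (Set.range v),
        exteriorPower.ιMulti K 3 (Function.update (Function.update u i x) j y) ∈
          LinearMap.range (wedgeDeriv (K := K) v) := by
      intro x hx y hy
      induction hx using Submodule.span_induction with
      | zero =>
        rw [Function.update_comm hij, AlternatingMap.map_update_zero]
        exact zero_mem _
      | add x x' _ _ h h' =>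
        rw [Function.update_comm hij, AlternatingMap.map_update_add, Function.update_comm hij.symm,
          Function.update_comm hij.symm]
        exact add_mem h h'
      | smul c x _ h =>
        rw [Function.update_comm hij, AlternatingMap.map_update_smul,
          Function.update_comm hij.symm]
        exact Submodule.smul_mem _ _ h
      | mem x hx =>
        obtain ⟨b, rfl⟩ := hx
        induction hy using Submodule.span_induction with
        | zero =>
          rw [AlternatingMap.map_update_zero]
          exact zero_mem _
        | add x x' _ _ h h' =>
          rw [AlternatingMap.map_update_add]
          exact add_mem h h'
        | smul c x _ h =>
          rw [AlternatingMap.map_update_smul]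
          exact Submodule.smul_mem _ _ h
        | mem y hy =>
          obtain ⟨c, rfl⟩ := hy
          by_cases hbc : b = c
          · subst hbc
            rw [AlternatingMap.map_eq_zero_of_eq _ _ (i := i) (j := j) (by simp [hij]) hij]
            exact zero_mem _
          · obtain ⟨σ, k, hσi, hσj, hk, hki⟩ : ∃ (σ : Equiv.Perm (Fin 3)) (k : Fin 3),
                σ i = b ∧ σ j = c ∧ (∀ l, l = i ∨ l = j ∨ l = k) ∧ k ≠ i ∧ k ≠ j := by
              clear hi hj
              revert i j b c; decide
            -- up to a permutation, the product is that of `v` with one vector replaced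
            have : Function.update (Function.update u i (v b)) j (v c) =
                Function.update v (σ k) (u k) ∘ σ := by
              funext l
              rcases hk l with rfl | rfl | rfl
              · rw [Function.update_of_ne hij, Function.update_self, Function.comp_apply,
                  Function.update_of_ne (σ.injective.ne hki.1.symm), hσi]
              · rw [Function.update_self, Function.comp_apply,
                  Function.update_of_ne (σ.injective.ne hki.2.symm), hσj]
              · rw [Function.update_of_ne hki.2, Function.update_of_ne hki.1, Function.comp_apply,
                  Function.update_self]
            rw [this, AlternatingMap.map_perm, ← wedgeDeriv_single]
            exact Submodule.smul_of_tower_mem _ _ ⟨_, rfl⟩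
    have := key _ hi _ hj
    rwa [Function.update_eq_self, Function.update_eq_self] at this

theorem map_tangentSpace {V' : Type*} [AddCommGroup V'] [Module K V'] (g : V ≃ₗ[K] V')
    (H : Submodule K V) :
    (tangentSpace H).map (exteriorPower.map 3 (g : V →ₗ[K] V')) =
      tangentSpace (H.map (g : V →ₗ[K] V')) := by
  rw [tangentSpace, tangentSpace, Submodule.map_span]
  congr 1
  ext x
  constructor
  · rintro ⟨_, ⟨u, ⟨i, j, hij, hi, hj⟩, rfl⟩, rfl⟩
    exact ⟨g ∘ u, ⟨i, j, hij, ⟨_, hi, rfl⟩, ⟨_, hj, rfl⟩⟩, by simp⟩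
  · rintro ⟨u, ⟨i, j, hij, ⟨x, hx, hxi⟩, ⟨y, hy, hyj⟩⟩, rfl⟩
    refine ⟨_, ⟨g.symm ∘ u, ⟨i, j, hij, ?_, ?_⟩, rfl⟩, ?_⟩
    · simpa [← hxi] using hx
    · simpa [← hyj] using hy
    · rw [exteriorPower.map_apply_ιMulti]
      congr 1
      ext; simp

end Tangent

section Jacobian

open MvPolynomial

variable {K : Type*} [Field K]

/-- The directional derivative of `f` at the point `t` along `w`. -/
def dirDeriv {τ : Type} [Fintype τ] (t w : τ → K) : MvPolynomial τ K →ₗ[K] K where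
  toFun f := ∑ s, eval t (pderiv s f) * w s
  map_add' f g := by simp [add_mul, Finset.sum_add_distrib]
  map_smul' c f := by simp [Finset.mul_sum, mul_assoc]

theorem dirDeriv_mul {τ : Type} [Fintype τ] (t w : τ → K) (f g : MvPolynomial τ K) :
    dirDeriv t w (f * g) = eval t f * dirDeriv t w g + eval t g * dirDeriv t w f := by
  simp only [dirDeriv, LinearMap.coe_mk, AddHom.coe_mk, Derivation.leibniz, smul_eq_mul, map_add,
    map_mul, add_mul, Finset.sum_add_distrib, Finset.mul_sum, mul_assoc]

theorem dirDeriv_X {τ : Type} [Fintype τ] (t w : τ → K) (s : τ) : dirDeriv t w (X s) = w s := by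
  classical
  simp [dirDeriv, pderiv_X, Pi.single_apply, apply_ite (eval t)]

theorem dirDeriv_det {τ : Type} [Fintype τ] (t w : τ → K) (c : Fin 3 → Fin 3 → τ) :
    dirDeriv t w (Matrix.of fun i j => X (c i j)).det =
      ∑ a, ((Matrix.of fun i j => t (c i j)).updateRow a fun j => w (c a j)).det := by
  simp only [Matrix.det_fin_three, Fin.sum_univ_three, map_sub, map_add, dirDeriv_mul, dirDeriv_X,
    Matrix.of_apply, map_mul, eval_X, Matrix.updateRow_apply]
  simp
  ring

/-- The polynomials giving the Plücker coordinates of a sum of `s` products of three vectors of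
`Kⁿ`. -/
def pluckerSum (K : Type*) [Field K] (n s : ℕ) (S : Set.powersetCard (Fin n) 3) :
    MvPolynomial (Fin s × Fin 3 × Fin n) K :=
  ∑ j, (Matrix.of fun a c => X (j, a, Set.powersetCard.ofFinEmbEquiv.symm S c)).det

theorem pluckerBasis_repr_ιMulti (n : ℕ) (v : Fin 3 → Fin n → K) (S : Set.powersetCard (Fin n) 3) :
    (pluckerBasis K 3 n).repr (exteriorPower.ιMulti K 3 v) S =
      (Matrix.of fun a c => v a (Set.powersetCard.ofFinEmbEquiv.symm S c)).det := by
  rw [pluckerBasis, exteriorPower.basis_repr_apply, exteriorPower.ιMultiDual_apply_ιMulti]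
  simp

theorem eval_pluckerSum {n s : ℕ} (v : Fin s → Fin 3 → Fin n → K)
    (S : Set.powersetCard (Fin n) 3) :
    eval (fun t => v t.1 t.2.1 t.2.2) (pluckerSum K n s S) =
      (pluckerBasis K 3 n).repr (∑ j, exteriorPower.ιMulti K 3 (v j)) S := by
  rw [map_sum, Finsupp.finsetSum_apply, pluckerSum, map_sum]
  refine Finset.sum_congr rfl fun j _ => ?_
  rw [pluckerBasis_repr_ιMulti, RingHom.map_det]
  congr 1
  ext
  simp

theorem isHomogeneous_det_fin_three {σ : Type*} {A : Matrix (Fin 3) (Fin 3) (MvPolynomial σ K)}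
    (hA : ∀ i j, (A i j).IsHomogeneous 1) : A.det.IsHomogeneous 3 := by
  have h : ∀ i j k a b c, (A i a * A j b * A k c).IsHomogeneous 3 := fun i j k a b c =>
    ((hA i a).mul (hA j b)).mul (hA k c)
  rw [Matrix.det_fin_three]
  exact (((((h _ _ _ _ _ _).sub (h _ _ _ _ _ _)).sub (h _ _ _ _ _ _)).add
    (h _ _ _ _ _ _)).add (h _ _ _ _ _ _)).sub (h _ _ _ _ _ _)

theorem isHomogeneous_pluckerSum (n s : ℕ) (S : Set.powersetCard (Fin n) 3) :
    (pluckerSum K n s S).IsHomogeneous 3 := by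
  exact IsHomogeneous.sum _ _ _ fun j _ =>
    isHomogeneous_det_fin_three fun _ _ => isHomogeneous_X K _

/-- The image of the differential of the parametrisation is the sum of the tangent spaces. -/
theorem rank_jacobian_pluckerSum {n s : ℕ} (v : Fin s → Fin 3 → Fin n → K) :
    (jacobian (pluckerSum K n s) fun t => v t.1 t.2.1 t.2.2).rank =
      Module.finrank K (⨆ j, tangentSpace (Submodule.span K (Set.range (v j))) :
        Submodule K (⋀[K]^3 (Fin n → K))) := by
  let D : (Fin s → Fin 3 → Fin n → K) →ₗ[K] ⋀[K]^3 (Fin n → K) :=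
    LinearMap.lsum K (fun _ => Fin 3 → Fin n → K) K fun j => wedgeDeriv (v j)
  have hD : LinearMap.range D = ⨆ j, tangentSpace (Submodule.span K (Set.range (v j))) := by
    simp_rw [← range_wedgeDeriv]
    apply le_antisymm
    · rintro _ ⟨w, rfl⟩
      have : D w = ∑ j, wedgeDeriv (v j) (w j) := by simp [D, LinearMap.lsum_apply]
      rw [this]
      exact Submodule.sum_mem _ fun j _ => Submodule.mem_iSup_of_mem j ⟨w j, rfl⟩
    · refine iSup_le fun j => ?_
      rintro _ ⟨w, rfl⟩
      exact ⟨Pi.single j w, LinearMap.lsum_piSingle (S := K) (f := fun j => wedgeDeriv (v j))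
        (i := j) (x := w)⟩
  let e : (Fin s × Fin 3 × Fin n → K) ≃ₗ[K] (Fin s → Fin 3 → Fin n → K) :=
    (LinearEquiv.curry K K (Fin s) (Fin 3 × Fin n)).trans
      (LinearEquiv.piCongrRight fun _ => LinearEquiv.curry K K (Fin 3) (Fin n))
  have hfac : (jacobian (pluckerSum K n s) fun t => v t.1 t.2.1 t.2.2).mulVecLin =
      (pluckerBasis K 3 n).equivFun.toLinearMap ∘ₗ D ∘ₗ e.toLinearMap := by
    refine LinearMap.ext fun w => funext fun S => ?_
    have h1 : ∀ w' : Fin s → Fin 3 → Fin n → K, (pluckerBasis K 3 n).equivFun (D w') S =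
        ∑ j, ∑ a, (pluckerBasis K 3 n).repr
          (exteriorPower.ιMulti K 3 (Function.update (v j) a (w' j a))) S := by
      intro w'
      simp [D, LinearMap.lsum_apply, wedgeDeriv_apply]
    have h2 : ((jacobian (pluckerSum K n s) fun t => v t.1 t.2.1 t.2.2).mulVecLin w) S =
      dirDeriv (fun t => v t.1 t.2.1 t.2.2) w (pluckerSum K n s S) := rfl
    rw [h2, LinearMap.comp_apply, LinearMap.comp_apply, LinearEquiv.coe_coe, h1, pluckerSum,
      map_sum]
    refine Finset.sum_congr rfl fun j _ => ?_
    rw [dirDeriv_det]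
    refine Finset.sum_congr rfl fun a _ => ?_
    rw [pluckerBasis_repr_ιMulti]
    congr 1
    ext i c
    by_cases hi : i = a
    · subst hi
      simp [e]
    · simp [hi]
  rw [Matrix.rank, hfac, ← hD, LinearMap.range_comp, LinearMap.range_comp,
    LinearEquiv.range, Submodule.map_top]
  exact LinearEquiv.finrank_map_eq _ _

end Jacobian

/-! ### The dimension of one tangent space -/

section OneSubspace

variable {K : Type*} [Field K]

theorem pluckerBasis_apply (n : ℕ) (S : Set.powersetCard (Fin n) 3) :
    pluckerBasis K 3 n S = exteriorPower.ιMulti K 3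
      (fun k => Pi.single (Set.powersetCard.ofFinEmbEquiv.symm S k) 1) := by
  rw [pluckerBasis, exteriorPower.basis_apply, exteriorPower.ιMulti_family]
  congr 1
  ext1 k
  simp

theorem pluckerBasis_mem_tangentSpace {n : ℕ} {H : Submodule K (Fin n → K)}
    {S : Set.powersetCard (Fin n) 3} {i j : Fin n} (hij : i ≠ j) (hiS : i ∈ S) (hjS : j ∈ S)
    (hi : Pi.single i 1 ∈ H) (hj : Pi.single j 1 ∈ H) : pluckerBasis K 3 n S ∈ tangentSpace H := by
  obtain ⟨k, hk⟩ := (Set.powersetCard.mem_range_ofFinEmbEquiv_symm_iff_mem S i).2 hiS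
  obtain ⟨l, hl⟩ := (Set.powersetCard.mem_range_ofFinEmbEquiv_symm_iff_mem S j).2 hjS
  rw [pluckerBasis_apply]
  refine ιMulti_mem_tangentSpace (i := k) (j := l) ?_ ?_ ?_
  · rintro rfl
    exact hij (hk.symm.trans hl)
  · rwa [hk]
  · rwa [hl]

variable {V : Type*} [AddCommGroup V] [Module K V]

/-- Infinitesimal changes of basis of trace zero do not move `v₁ ∧ v₂ ∧ v₃`. -/
theorem wedgeDeriv_matrix (v : Fin 3 → V) (C : Matrix (Fin 3) (Fin 3) K) :
    wedgeDeriv (K := K) v (fun a => ∑ b, C a b • v b) =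
      C.trace • exteriorPower.ιMulti K 3 v := by
  rw [wedgeDeriv_apply, Matrix.trace, Finset.sum_smul]
  refine Finset.sum_congr rfl fun a _ => ?_
  rw [AlternatingMap.map_update_sum, Finset.sum_eq_single a]
  · rw [AlternatingMap.map_update_smul, Function.update_eq_self, Matrix.diag_apply]
  · intro b _ hb
    rw [AlternatingMap.map_update_smul, AlternatingMap.map_update_self _ _ hb.symm, smul_zero]
  · simp

/-- The kernel of the differential contains the `8`-dimensional space of infinitesimal changes of
basis of trace zero. -/
theorem finrank_tangentSpace_le {n : ℕ} {v : Fin 3 → Fin n → K} (hv : LinearIndependent K v) :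
    Module.finrank K (tangentSpace (Submodule.span K (Set.range v))) + 8 ≤ 3 * n := by
  have h1 := LinearMap.finrank_range_add_finrank_ker (wedgeDeriv (K := K) v)
  rw [range_wedgeDeriv, Module.finrank_pi_fintype] at h1
  simp only [Module.finrank_fin_fun, Finset.sum_const, Finset.card_univ, Fintype.card_fin,
    smul_eq_mul] at h1
  have h2 : 8 ≤ Module.finrank K (LinearMap.ker (Matrix.traceLinearMap (Fin 3) K K)) := by
    have h3 := LinearMap.finrank_range_add_finrank_ker (Matrix.traceLinearMap (Fin 3) K K)
    have h4 := Submodule.finrank_le (LinearMap.range (Matrix.traceLinearMap (Fin 3) K K))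
    rw [Module.finrank_matrix] at h3
    simp only [Fintype.card_fin, Module.finrank_self] at h3 h4
    omega
  let f : Matrix (Fin 3) (Fin 3) K →ₗ[K] (Fin 3 → Fin n → K) :=
    { toFun := fun C a => ∑ b, C a b • v b
      map_add' := fun C D => by ext1 a; simp [add_smul, Finset.sum_add_distrib]
      map_smul' := fun c C => by ext1 a; simp [Finset.smul_sum, mul_smul] }
  have hf : Function.Injective f := by
    rw [injective_iff_map_eq_zero]
    intro C hC
    ext a b
    exact Fintype.linearIndependent_iff.1 hv _ (congrFun hC a) b
  have h5 : (LinearMap.ker (Matrix.traceLinearMap (Fin 3) K K)).map f ≤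
      LinearMap.ker (wedgeDeriv (K := K) v) := by
    rintro _ ⟨C, hC, rfl⟩
    rw [LinearMap.mem_ker]
    refine (wedgeDeriv_matrix v C).trans ?_
    have : C.trace = 0 := hC
    rw [this, zero_smul]
  have h6 := Submodule.finrank_mono h5
  rw [← (Submodule.equivMapOfInjective f hf _).finrank_eq] at h6
  omega

/-- The tangent space at `⟨e₁, e₂, e₃⟩` contains the `19` standard basis vectors of `⋀³ K⁹` with at
least two indices in `{1, 2, 3}`. -/
theorem le_finrank_tangentSpace :
    19 ≤ Module.finrank K (tangentSpace (Submodule.span K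
      (Set.range (normalForm K 0)))) := by
  classical
  let A : Finset (Finset (Fin 9)) :=
    (Finset.powersetCard 3 Finset.univ).filter fun S => 2 ≤ (S ∩ {0, 1, 2}).card
  have hA : A.card = 19 := by decide +kernel
  let f : A → Set.powersetCard (Fin 9) 3 := fun S =>
    ⟨S, (Finset.mem_powersetCard.1 (Finset.mem_filter.1 S.2).1).2⟩
  have hf : Function.Injective f := fun S S' h =>
    Subtype.ext (congrArg (fun T : Set.powersetCard (Fin 9) 3 => (T : Finset (Fin 9))) h)
  have h1 : LinearIndependent K (fun S : A => pluckerBasis K 3 9 (f S)) :=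
    (pluckerBasis K 3 9).linearIndependent.comp _ hf
  have h2 := finrank_span_eq_card h1
  rw [Fintype.card_coe, hA] at h2
  rw [← h2]
  apply Submodule.finrank_mono
  rw [Submodule.span_le]
  rintro _ ⟨⟨S, hS⟩, rfl⟩
  have hS' : 1 < (S ∩ {0, 1, 2}).card := (Finset.mem_filter.1 hS).2
  obtain ⟨i, hi, j, hj, hij⟩ := Finset.one_lt_card.1 hS'
  have hmem : ∀ i ∈ ({0, 1, 2} : Finset (Fin 9)),
      (Pi.single i 1 : Fin 9 → K) ∈ Submodule.span K (Set.range (normalForm K 0)) := by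
    intro i hi
    simp only [Finset.mem_insert, Finset.mem_singleton] at hi
    rcases hi with rfl | rfl | rfl
    · exact Submodule.subset_span ⟨0, rfl⟩
    · exact Submodule.subset_span ⟨1, rfl⟩
    · exact Submodule.subset_span ⟨2, rfl⟩
  rw [Finset.mem_inter] at hi hj
  exact pluckerBasis_mem_tangentSpace hij hi.1 hj.1 (hmem i hi.2) (hmem j hj.2)

end OneSubspace

/-! ### The tangent spaces at the four subspaces in normal form -/

section FourSubspaces

variable (K : Type*) [Field K]

/-- The sum of the tangent spaces at the four subspaces `⟨v j 0, v j 1, v j 2⟩`. -/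
def sumTangentSpace {V : Type*} [AddCommGroup V] [Module K V] {s : ℕ} (v : Fin s → Fin 3 → V) :
    Submodule K (⋀[K]^3 V) :=
  ⨆ j, tangentSpace (Submodule.span K (Set.range (v j)))

/-- The index of the `a`-th basis vector of the `k`-th block of three. -/
def blk (k a : Fin 3) : Fin 9 := ⟨3 * k + a, by omega⟩

theorem blk_eq_blk_iff : ∀ {k l a b : Fin 3}, blk l b = blk k a ↔ l = k ∧ b = a := by
  decide

/-- `K⁹ = K³ ⊗ K³` as a space of triples of linear forms: `block K k w` is the linear form in
three variables whose coefficients are the `k`-th block of coordinates of `w`. -/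
def block (k : Fin 3) : (Fin 9 → K) →ₗ[K] MvPolynomial (Fin 3) K where
  toFun w := ∑ a, w (blk k a) • MvPolynomial.X a
  map_add' v w := by simp [add_smul, Finset.sum_add_distrib]
  map_smul' c w := by simp [Finset.smul_sum, mul_smul]

/-- The contraction `⋀³(K³ ⊗ K³) → S³(K³)` that sends `v₁ ∧ v₂ ∧ v₃` to the determinant of the
`3 × 3` matrix of their blocks. -/
def cubicMap : ⋀[K]^3 (Fin 9 → K) →ₗ[K] MvPolynomial (Fin 3) K :=
  exteriorPower.alternatingMapLinearEquiv
    { ((Matrix.detRowAlternating (n := Fin 3)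
        (R := MvPolynomial (Fin 3) K)).toMultilinearMap.restrictScalars K).compLinearMap
          fun _ => LinearMap.pi (block K) with
      map_eq_zero_of_eq' := fun v i j hv hij =>
        Matrix.det_zero_of_row_eq hij (by simp only [hv]) }

theorem cubicMap_ιMulti (v : Fin 3 → Fin 9 → K) :
    cubicMap K (exteriorPower.ιMulti K 3 v) = (Matrix.of fun i k => block K k (v i)).det := by
  rw [cubicMap, exteriorPower.alternatingMapLinearEquiv_apply_ιMulti]
  rfl

/-- The vectors `e_{k,f(k)}`, one from each block. -/
def transversal (f : Fin 3 → Fin 3) (k : Fin 3) : Fin 9 → K := e K (blk k (f k))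

theorem block_e (k l a : Fin 3) :
    block K l (e K (blk k a)) = if l = k then MvPolynomial.X a else 0 := by
  simp only [block, LinearMap.coe_mk, AddHom.coe_mk, e, Pi.single_apply, blk_eq_blk_iff]
  split_ifs with hl <;> simp [hl]

theorem cubicMap_transversal (f : Fin 3 → Fin 3) :
    cubicMap K (exteriorPower.ιMulti K 3 (transversal K f)) = ∏ k, MvPolynomial.X (f k) := by
  rw [cubicMap_ιMulti, ← Matrix.det_diagonal]
  congr 1
  ext1 i k
  rw [Matrix.of_apply, transversal, block_e, Matrix.diagonal_apply]
  by_cases h : i = k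
  · simp [h]
  · simp [h, Ne.symm h]

/-- The vectors of `K³` that describe the four subspaces `K³ ⊗ c j` of `K³ ⊗ K³`. -/
def coeffVec : Fin 4 → Fin 3 → K := ![![1, 0, 0], ![0, 1, 0], ![0, 0, 1], ![1, 1, 1]]

theorem normalForm_eq (j : Fin 4) (a : Fin 3) :
    normalForm K j a = ∑ k, coeffVec K j k • e K (blk k a) := by
  fin_cases j <;> fin_cases a <;> simp [normalForm, coeffVec, Fin.sum_univ_three, blk]

theorem normalForm_three (a : Fin 3) : normalForm K 3 a = ∑ k, e K (blk k a) := by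
  rw [normalForm_eq]
  exact Finset.sum_congr rfl fun k _ => by fin_cases k <;> simp [coeffVec]

/-- The blocks of a vector of `K³ ⊗ c j` are multiples of one linear form. -/
theorem exists_block_eq {j : Fin 4} {w : Fin 9 → K}
    (hw : w ∈ Submodule.span K (Set.range (normalForm K j))) :
    ∃ p : MvPolynomial (Fin 3) K, ∀ k, block K k w = p * MvPolynomial.C (coeffVec K j k) := by
  induction hw using Submodule.span_induction with
  | zero => exact ⟨0, fun k => by simp⟩
  | add x y _ _ hx hy =>
    obtain ⟨p, hp⟩ := hx
    obtain ⟨q, hq⟩ := hy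
    exact ⟨p + q, fun k => by rw [map_add, hp, hq, add_mul]⟩
  | smul c x _ hx =>
    obtain ⟨p, hp⟩ := hx
    exact ⟨c • p, fun k => by rw [map_smul, hp, smul_mul_assoc]⟩
  | mem x hx =>
    obtain ⟨a, rfl⟩ := hx
    refine ⟨MvPolynomial.X a, fun k => ?_⟩
    rw [normalForm_eq, map_sum]
    simp only [map_smul, block_e, smul_ite, smul_zero]
    simp [MvPolynomial.smul_eq_C_mul, mul_comm]

/-- If two of the three vectors lie in one of the four subspaces, two rows of the matrix of blocks
are proportional. -/
theorem sumTangentSpace_le_ker_cubicMap :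
    sumTangentSpace K (normalForm K) ≤ LinearMap.ker (cubicMap K) := by
  refine iSup_le fun l => Submodule.span_le.2 ?_
  rintro _ ⟨u, ⟨i, j, hij, hi, hj⟩, rfl⟩
  obtain ⟨p, hp⟩ := exists_block_eq K hi
  obtain ⟨q, hq⟩ := exists_block_eq K hj
  rw [SetLike.mem_coe, LinearMap.mem_ker, cubicMap_ιMulti]
  have h1 : (Matrix.of fun i k => block K k (u i)) =
      ((Matrix.of fun i k => block K k (u i)).updateRow i
        (p • fun k => MvPolynomial.C (coeffVec K l k))).updateRow j
        (q • fun k => MvPolynomial.C (coeffVec K l k)) := by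
    ext1 i' k
    by_cases h1 : i' = j
    · subst h1
      simp [hq]
    · by_cases h2 : i' = i
      · subst h2
        simp [h1, hp]
      · simp [h1, h2]
  rw [h1, Matrix.det_updateRow_smul, Matrix.updateRow_comm _ hij, Matrix.det_updateRow_smul,
    Matrix.det_zero_of_row_eq hij, mul_zero, mul_zero]
  rw [Matrix.updateRow_self, Matrix.updateRow_ne hij.symm, Matrix.updateRow_self]

theorem e_blk_mem_span (k a : Fin 3) :
    e K (blk k a) ∈ Submodule.span K (Set.range (normalForm K k.castSucc)) := by
  refine Submodule.subset_span ⟨a, ?_⟩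
  rw [normalForm_eq, Finset.sum_eq_single k]
  · fin_cases k <;> simp [coeffVec]
  · intro b _ hb
    revert hb
    fin_cases k <;> fin_cases b <;> simp [coeffVec]
  · simp

theorem ιMulti_mem_sumTangentSpace {V : Type*} [AddCommGroup V] [Module K V] {s : ℕ}
    {v : Fin s → Fin 3 → V} {u : Fin 3 → V} (l : Fin s) {i j : Fin 3} (hij : i ≠ j)
    (hi : u i ∈ Submodule.span K (Set.range (v l)))
    (hj : u j ∈ Submodule.span K (Set.range (v l))) :
    exteriorPower.ιMulti K 3 u ∈ sumTangentSpace K v :=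
  Submodule.mem_iSup_of_mem l (ιMulti_mem_tangentSpace hij hi hj)

/-- Modulo the tangent spaces, the products of transversal vectors are symmetric: expand the
product with the two vectors replaced by the corresponding vectors of the fourth subspace. -/
theorem transversal_swap_sub_mem (f : Fin 3 → Fin 3) {i j : Fin 3} (hij : i ≠ j) :
    exteriorPower.ιMulti K 3 (transversal K f) -
      exteriorPower.ιMulti K 3 (transversal K (f ∘ Equiv.swap i j)) ∈
      sumTangentSpace K (normalForm K) := by
  let u := transversal K f
  let F : Fin 3 × Fin 3 → ⋀[K]^3 (Fin 9 → K) := fun p => exteriorPower.ιMulti K 3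
    (Function.update (Function.update u i (e K (blk p.1 (f i)))) j (e K (blk p.2 (f j))))
  have hsum : ∑ p, F p ∈ sumTangentSpace K (normalForm K) := by
    have h1 : ∑ p, F p = exteriorPower.ιMulti K 3
        (Function.update (Function.update u i (normalForm K 3 (f i))) j
          (normalForm K 3 (f j))) := by
      rw [normalForm_three, normalForm_three, Function.update_comm hij,
        AlternatingMap.map_update_sum, Fintype.sum_prod_type]
      refine Finset.sum_congr rfl fun k _ => ?_
      rw [Function.update_comm hij.symm, AlternatingMap.map_update_sum]
    rw [h1]
    refine ιMulti_mem_sumTangentSpace K 3 hij ?_ ?_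
    · rw [Function.update_of_ne hij, Function.update_self]
      exact Submodule.subset_span ⟨_, rfl⟩
    · rw [Function.update_self]
      exact Submodule.subset_span ⟨_, rfl⟩
  have hrest : ∀ p : Fin 3 × Fin 3, p ≠ (i, j) → p ≠ (j, i) →
      F p ∈ sumTangentSpace K (normalForm K) := by
    rintro ⟨k, l⟩ h1 h2
    have hcases : ∀ i j k l : Fin 3, i ≠ j → (k, l) ≠ (i, j) → (k, l) ≠ (j, i) →
        k = l ∨ ((k ≠ i ∧ k ≠ j) ∨ (l ≠ i ∧ l ≠ j)) := by decide
    rcases hcases i j k l hij h1 h2 with rfl | ⟨hi, hj⟩ | ⟨hi, hj⟩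
    · refine ιMulti_mem_sumTangentSpace K k.castSucc hij ?_ ?_
      · rw [Function.update_of_ne hij, Function.update_self]
        exact e_blk_mem_span K _ _
      · rw [Function.update_self]
        exact e_blk_mem_span K _ _
    · refine ιMulti_mem_sumTangentSpace K k.castSucc hi ?_ ?_
      · rw [Function.update_of_ne hj, Function.update_of_ne hi]
        exact e_blk_mem_span K _ _
      · rw [Function.update_of_ne hij, Function.update_self]
        exact e_blk_mem_span K _ _
    · refine ιMulti_mem_sumTangentSpace K l.castSucc hj ?_ ?_
      · rw [Function.update_of_ne hj, Function.update_of_ne hi]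
        exact e_blk_mem_span K _ _
      · rw [Function.update_self]
        exact e_blk_mem_span K _ _
  have hF1 : F (i, j) = exteriorPower.ιMulti K 3 u := by
    change exteriorPower.ιMulti K 3 (Function.update (Function.update u i (u i)) j (u j)) = _
    rw [Function.update_eq_self, Function.update_eq_self]
  have hF2 : F (j, i) = - exteriorPower.ιMulti K 3 (transversal K (f ∘ Equiv.swap i j)) := by
    rw [← (exteriorPower.ιMulti K 3).map_swap (transversal K (f ∘ Equiv.swap i j)) hij]
    refine congrArg (exteriorPower.ιMulti K 3) ?_
    funext l
    by_cases h1 : l = j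
    · subst h1
      simp [transversal]
    · by_cases h2 : l = i
      · subst h2
        simp [transversal, hij]
      · simp [transversal, h1, h2, Equiv.swap_apply_of_ne_of_ne h2 h1, u]
  have hne : (j, i) ∈ Finset.univ.erase (i, j) := by
    simp [hij, Ne.symm hij]
  rw [← Finset.add_sum_erase _ _ (Finset.mem_univ (i, j)), ← Finset.add_sum_erase _ _ hne,
    ← add_assoc, hF1, hF2, ← sub_eq_add_neg] at hsum
  refine (Submodule.add_mem_iff_left _ (Submodule.sum_mem _ fun p hp => ?_)).1 hsum
  rw [Finset.mem_erase, Finset.mem_erase] at hp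
  exact hrest p hp.2.1 hp.1

theorem transversal_perm_sub_mem (f : Fin 3 → Fin 3) (σ : Equiv.Perm (Fin 3)) :
    exteriorPower.ιMulti K 3 (transversal K f) -
      exteriorPower.ιMulti K 3 (transversal K (f ∘ σ)) ∈
      sumTangentSpace K (normalForm K) := by
  induction σ using Equiv.Perm.swap_induction_on' with
  | one => simp
  | mul_swap σ x y hxy h =>
    have := add_mem h (transversal_swap_sub_mem K (f ∘ σ) hxy)
    rwa [sub_add_sub_cancel] at this

/-- The monotone maps index the monomials of degree three in three variables. -/
abbrev Mono : Type := {f : Fin 3 → Fin 3 // f 0 ≤ f 1 ∧ f 1 ≤ f 2}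

theorem card_mono : Fintype.card Mono = 10 := by decide

/-- A product of three standard basis vectors either has two factors in one block, and then is
tangent, or is up to sign a transversal product, whose factors can be sorted. -/
theorem pluckerBasis_mem_sup_span (S : Set.powersetCard (Fin 9) 3) : pluckerBasis K 3 9 S ∈
    sumTangentSpace K (normalForm K) ⊔ Submodule.span K
      (Set.range fun f : Mono => exteriorPower.ιMulti K 3 (transversal K f)) := by
  have hblk : ∀ x, ∃ k a, x = blk k a := by decide
  choose κ α hκ using fun l => hblk (Set.powersetCard.ofFinEmbEquiv.symm S l)
  rw [pluckerBasis_apply]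
  by_cases hinj : Function.Injective κ
  · let σ := Equiv.ofBijective κ (Finite.injective_iff_bijective.1 hinj)
    let f := α ∘ σ.symm
    have h1 : (fun l => Pi.single (Set.powersetCard.ofFinEmbEquiv.symm S l) 1) =
        transversal K f ∘ σ := by
      funext l
      have h2 : f (σ l) = α l := congrArg α (σ.symm_apply_apply l)
      rw [hκ, Function.comp_apply, transversal, h2]
      rfl
    rw [h1, AlternatingMap.map_perm]
    refine Submodule.smul_of_tower_mem _ _ ?_
    have h2 := transversal_perm_sub_mem K f (Tuple.sort f)
    rw [← sub_add_cancel (exteriorPower.ιMulti K 3 (transversal K f))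
      (exteriorPower.ιMulti K 3 (transversal K (f ∘ Tuple.sort f)))]
    have hmono := Tuple.monotone_sort f
    exact Submodule.add_mem_sup h2 (Submodule.subset_span
      ⟨⟨f ∘ Tuple.sort f, hmono (by decide), hmono (by decide)⟩, rfl⟩)
  · obtain ⟨l, l', hl, hne⟩ := Function.not_injective_iff.1 hinj
    refine Submodule.mem_sup_left (ιMulti_mem_sumTangentSpace K (κ l).castSucc hne ?_ ?_)
    · rw [hκ]
      exact e_blk_mem_span K _ _
    · rw [hκ, hl]
      exact e_blk_mem_span K _ _

theorem sumTangentSpace_sup_span :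
    sumTangentSpace K (normalForm K) ⊔ Submodule.span K
      (Set.range fun f : Mono => exteriorPower.ιMulti K 3 (transversal K f)) = ⊤ := by
  rw [eq_top_iff, ← (pluckerBasis K 3 9).span_eq, Submodule.span_le]
  rintro _ ⟨S, rfl⟩
  exact pluckerBasis_mem_sup_span K S

theorem linearIndependent_monomials : LinearIndependent K
    (fun f : Mono => (∏ k, MvPolynomial.X (f.1 k) : MvPolynomial (Fin 3) K)) := by
  let d : Mono → (Fin 3 →₀ ℕ) := fun f => ∑ k, Finsupp.single (f.1 k) 1
  have hd : Function.Injective d := by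
    have h : ∀ f g : Mono, (∀ a, (Finset.univ.filter fun k => f.1 k = a).card =
        (Finset.univ.filter fun k => g.1 k = a).card) → f = g := by decide
    intro f g hfg
    apply h
    intro a
    have h1 : ∀ f : Mono, d f a = (Finset.univ.filter fun k => f.1 k = a).card := by
      intro f
      simp [d, Finsupp.single_apply]
    rw [← h1, ← h1, hfg]
  have h := (MvPolynomial.basisMonomials (Fin 3) K).linearIndependent.comp d hd
  have h2 : (fun f : Mono => (∏ k, MvPolynomial.X (f.1 k) : MvPolynomial (Fin 3) K)) =
      MvPolynomial.basisMonomials (Fin 3) K ∘ d := by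
    funext f
    simp [d, MvPolynomial.monomial_sum_one, MvPolynomial.X]
  rw [h2]
  exact h

theorem finrank_exteriorPower : Module.finrank K (⋀[K]^3 (Fin 9 → K)) = 84 := by
  rw [exteriorPower.finrank_eq, Module.finrank_fin_fun]
  rfl

/-- The image of `cubicMap` contains the ten cubic monomials, and `84 - 10 = 74`. -/
theorem finrank_ker_cubicMap_le : Module.finrank K (LinearMap.ker (cubicMap K)) ≤ 74 := by
  have h1 := LinearMap.finrank_range_add_finrank_ker (cubicMap K)
  rw [finrank_exteriorPower] at h1
  have h2 := finrank_span_eq_card (linearIndependent_monomials K)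
  rw [card_mono] at h2
  have h3 : Submodule.span K (Set.range
      (fun f : Mono => (∏ k, MvPolynomial.X (f.1 k) : MvPolynomial (Fin 3) K))) ≤
      LinearMap.range (cubicMap K) := by
    rw [Submodule.span_le]
    rintro _ ⟨f, rfl⟩
    exact ⟨_, cubicMap_transversal K f⟩
  have h4 := Submodule.finrank_mono h3
  omega

/-- Ten transversal products span a complement of the sum of the tangent spaces. -/
theorem le_finrank_sumTangentSpace :
    74 ≤ Module.finrank K (sumTangentSpace K (normalForm K)) := by
  have h1 := Submodule.finrank_add_le_finrank_add_finrank (sumTangentSpace K (normalForm K))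
    (Submodule.span K (Set.range fun f : Mono => exteriorPower.ιMulti K 3 (transversal K f)))
  rw [sumTangentSpace_sup_span, finrank_top, finrank_exteriorPower] at h1
  have h2 := finrank_range_le_card (R := K)
    (fun f : Mono => exteriorPower.ιMulti K 3 (transversal K f))
  rw [card_mono, Set.finrank] at h2
  omega

/-- The sum of the tangent spaces lies in the kernel of `cubicMap`, and `74` bounds its dimension
from below and that of the kernel from above. -/
theorem sumTangentSpace_eq_ker_cubicMap :
    sumTangentSpace K (normalForm K) = LinearMap.ker (cubicMap K) :=
  Submodule.eq_of_le_of_finrank_le (sumTangentSpace_le_ker_cubicMap K)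
    ((finrank_ker_cubicMap_le K).trans (le_finrank_sumTangentSpace K))

theorem finrank_sumTangentSpace :
    Module.finrank K (sumTangentSpace K (normalForm K)) = 74 := by
  apply le_antisymm _ (le_finrank_sumTangentSpace K)
  rw [sumTangentSpace_eq_ker_cubicMap]
  exact finrank_ker_cubicMap_le K

theorem finrank_sumTangentSpace_map_le {V : Type*} [AddCommGroup V] [Module K V] {s : ℕ}
    [Module.Finite K V] {v w : Fin s → Fin 3 → V} (g : V ≃ₗ[K] V)
    (hg : ∀ i, (Submodule.span K (Set.range (v i))).map (g : V →ₗ[K] V) =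
      Submodule.span K (Set.range (w i))) :
    Module.finrank K (sumTangentSpace K w) ≤ Module.finrank K (sumTangentSpace K v) := by
  have : sumTangentSpace K w =
      (sumTangentSpace K v).map (exteriorPower.map 3 (g : V →ₗ[K] V)) := by
    rw [sumTangentSpace, sumTangentSpace, Submodule.map_iSup]
    simp_rw [map_tangentSpace, hg]
  rw [this]
  exact Submodule.finrank_map_le _ _

end FourSubspaces

/-! ### Squares of ideals in the exterior algebra -/

section Squares

variable {K : Type*} [Field K] {V : Type*} [AddCommGroup V] [Module K V]

theorem span_range_ι {k : ℕ} (v : Fin k → V) :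
    Submodule.span K (Set.range fun i => ExteriorAlgebra.ι K (v i)) =
      (Submodule.span K (Set.range v)).map (ExteriorAlgebra.ι K) := by
  rw [Submodule.map_span, ← Set.range_comp]
  rfl

/-- Vectors can be moved to the right of any element, so that the left ideal generated by
vectors is two-sided. -/
theorem exists_ι_mul_eq_mul_ι (a : V) (y : ExteriorAlgebra K V) :
    ∃ z : ExteriorAlgebra K V, ExteriorAlgebra.ι K a * y = z * ExteriorAlgebra.ι K a := by
  induction y using ExteriorAlgebra.induction with
  | algebraMap r => exact ⟨algebraMap K _ r, (Algebra.commutes r _).symm⟩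
  | ι b => exact ⟨-ExteriorAlgebra.ι K b, by
      rw [neg_mul]; exact eq_neg_of_add_eq_zero_left (ExteriorAlgebra.ι_add_mul_swap a b)⟩
  | mul x y hx hy =>
    obtain ⟨x', hx⟩ := hx
    obtain ⟨y', hy⟩ := hy
    exact ⟨x' * y', by rw [← mul_assoc, hx, mul_assoc, hy, mul_assoc]⟩
  | add x y hx hy =>
    obtain ⟨x', hx⟩ := hx
    obtain ⟨y', hy⟩ := hy
    exact ⟨x' + y', by rw [mul_add, hx, hy, add_mul]⟩

theorem span_mul_top_le {k : ℕ} (v : Fin k → V) :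
    Submodule.span K (Set.range fun i => ExteriorAlgebra.ι K (v i)) * ⊤ ≤
      ⊤ * Submodule.span K (Set.range fun i => ExteriorAlgebra.ι K (v i)) := by
  rw [Submodule.mul_le]
  intro m hm n _
  induction hm using Submodule.span_induction with
  | zero => rw [zero_mul]; exact zero_mem _
  | add x y _ _ hx hy => rw [add_mul]; exact add_mem hx hy
  | smul c x _ hx => rw [smul_mul_assoc]; exact Submodule.smul_mem _ _ hx
  | mem x hx =>
    obtain ⟨i, rfl⟩ := hx
    obtain ⟨z, hz⟩ := exists_ι_mul_eq_mul_ι (K := K) (v i) n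
    simp only [hz]
    exact Submodule.mul_mem_mul trivial (Submodule.subset_span ⟨i, rfl⟩)

theorem top_mul_top_exteriorAlgebra :
    (⊤ * ⊤ : Submodule K (ExteriorAlgebra K V)) = ⊤ :=
  top_le_iff.1 fun x _ => by
    rw [← mul_one x]
    exact Submodule.mul_mem_mul trivial trivial

theorem extIdeal_sq_le {k : ℕ} (v : Fin k → V) : extIdeal (K := K) v ^ 2 ≤
    ⊤ * (Submodule.span K (Set.range fun i => ExteriorAlgebra.ι K (v i)) *
      Submodule.span K (Set.range fun i => ExteriorAlgebra.ι K (v i))) := by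
  have h1 : extIdeal (K := K) v ≤
      ⊤ * Submodule.span K (Set.range fun i => ExteriorAlgebra.ι K (v i)) := by
    rw [extIdeal, mul_assoc]
    refine (mul_le_mul_right (span_mul_top_le v) ⊤).trans ?_
    rw [← mul_assoc, top_mul_top_exteriorAlgebra]
  rw [pow_two]
  refine (mul_le_mul' h1 h1).trans ?_
  rw [mul_assoc, ← mul_assoc (Submodule.span K _) ⊤]
  refine (mul_le_mul_right (mul_le_mul_left (span_mul_top_le v) _) ⊤).trans ?_
  rw [← mul_assoc, ← mul_assoc, ← mul_assoc, top_mul_top_exteriorAlgebra]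

/-- The product of four vectors of a three-dimensional space vanishes. -/
theorem ιMulti_four_eq_zero {v : Fin 3 → V} {u : Fin 4 → V}
    (hu : ∀ i, u i ∈ Submodule.span K (Set.range v)) : ExteriorAlgebra.ιMulti K 4 u = 0 := by
  apply AlternatingMap.map_linearDependent
  intro hli
  have h1 : LinearIndependent K fun i => (⟨u i, hu i⟩ : Submodule.span K (Set.range v)) :=
    LinearIndependent.of_comp (Submodule.subtype _) hli
  have := FiniteDimensional.span_of_finite K (Set.finite_range v)
  have h2 := h1.fintype_card_le_finrank
  have h3 := finrank_range_le_card (R := K) v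
  rw [Set.finrank] at h3
  simp only [Fintype.card_fin] at h2 h3
  omega

/-- The square of the ideal of `H` annihilates the tangent space at `H`, because the product has
four factors in `H`. -/
theorem mul_ιMulti_eq_zero {v : Fin 3 → V} {ω : ExteriorAlgebra K V}
    (hω : ω ∈ extIdeal (K := K) v ^ 2) {x : ⋀[K]^3 V}
    (hx : x ∈ tangentSpace (Submodule.span K (Set.range v))) :
    ω * (x : ExteriorAlgebra K V) = 0 := by
  have key : ∀ a ∈ Submodule.span K (Set.range v), ∀ b ∈ Submodule.span K (Set.range v),
      ω * (ExteriorAlgebra.ι K a * ExteriorAlgebra.ι K b) = 0 := by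
    intro a ha b hb
    have h0 := extIdeal_sq_le v hω
    simp only [span_range_ι] at h0
    clear hω
    induction h0 using Submodule.mul_induction_on' with
    | add x _ y _ hx hy => rw [add_mul, hx, hy, add_zero]
    | mem_mul_mem m _ n hn =>
      rw [mul_assoc]
      suffices n * (ExteriorAlgebra.ι K a * ExteriorAlgebra.ι K b) = 0 by rw [this, mul_zero]
      induction hn using Submodule.mul_induction_on' with
      | add x _ y _ hx hy => rw [add_mul, hx, hy, add_zero]
      | mem_mul_mem m hm n hn =>
        obtain ⟨c, hc, rfl⟩ := hm
        obtain ⟨d, hd, rfl⟩ := hn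
        have h1 : ExteriorAlgebra.ιMulti K 4 ![c, d, a, b] = 0 := by
          apply ιMulti_four_eq_zero (v := v)
          intro i
          fin_cases i <;> assumption
        rw [ExteriorAlgebra.ιMulti_apply] at h1
        simpa [List.ofFn_succ, mul_assoc] using h1
  induction hx using Submodule.span_induction with
  | zero => simp
  | add x y _ _ hx hy => rw [Submodule.coe_add, mul_add, hx, hy, add_zero]
  | smul c x _ hx => rw [Submodule.coe_smul, mul_smul_comm, hx, smul_zero]
  | mem x hx =>
    obtain ⟨u, ⟨i, j, hij, hi, hj⟩, rfl⟩ := hx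
    obtain ⟨σ, h0, h1⟩ : ∃ σ : Equiv.Perm (Fin 3), σ 0 = i ∧ σ 1 = j := by
      clear hi hj
      revert i j; decide
    have h2 : ω * ExteriorAlgebra.ιMulti K 3 (u ∘ σ) = 0 := by
      rw [ExteriorAlgebra.ιMulti_apply]
      simp only [List.ofFn_succ, List.ofFn_zero, List.prod_cons, List.prod_nil, mul_one,
        Function.comp_apply, Fin.succ_zero_eq_one, h0, h1]
      rw [← mul_assoc (ExteriorAlgebra.ι K (u i)), ← mul_assoc ω, key _ hi _ hj, zero_mul]
    rw [AlternatingMap.map_perm] at h2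
    rw [exteriorPower.ιMulti_apply_coe]
    rcases Int.units_eq_one_or (Equiv.Perm.sign σ) with h | h
    · simpa [h] using h2
    · simpa [h] using h2

theorem mul_mem_extIdeal_sq {k : ℕ} {v : Fin k → V} {x y : V}
    (hx : x ∈ Submodule.span K (Set.range v)) (hy : y ∈ Submodule.span K (Set.range v))
    (a c : ExteriorAlgebra K V) :
    a * (ExteriorAlgebra.ι K x * ExteriorAlgebra.ι K y) * c ∈ extIdeal (K := K) v ^ 2 := by
  have h : ∀ x ∈ Submodule.span K (Set.range v), ∀ a c, a * ExteriorAlgebra.ι K x * c ∈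
      extIdeal (K := K) v := by
    intro x hx a c
    rw [extIdeal, span_range_ι]
    exact Submodule.mul_mem_mul (Submodule.mul_mem_mul trivial ⟨x, hx, rfl⟩) trivial
  have h1 := Submodule.mul_mem_mul (h x hx a 1) (h y hy 1 c)
  rw [← pow_two] at h1
  simpa [mul_assoc] using h1

/-- Linear isomorphisms carry the degree `d` parts of the intersections of the squares to
each other. -/
theorem finrank_squaresPart_eq {s k : ℕ} [NeZero s] {v w : Fin s → Fin k → V} (g : V ≃ₗ[K] V)
    (hg : ∀ i, (Submodule.span K (Set.range (v i))).map (g : V →ₗ[K] V) =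
      Submodule.span K (Set.range (w i))) (d : ℕ) :
    Module.finrank K (squaresPart (K := K) w d) = Module.finrank K (squaresPart (K := K) v d) := by
  let φ : ExteriorAlgebra K V ≃ₐ[K] ExteriorAlgebra K V :=
    AlgEquiv.ofAlgHom (ExteriorAlgebra.map (g : V →ₗ[K] V))
      (ExteriorAlgebra.map (g.symm : V →ₗ[K] V))
      (by rw [ExteriorAlgebra.map_comp_map]; simp)
      (by rw [ExteriorAlgebra.map_comp_map]; simp)
  have hφ : ∀ H : Submodule K V, (H.map (ExteriorAlgebra.ι K)).map φ.toLinearMap =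
      (H.map (g : V →ₗ[K] V)).map (ExteriorAlgebra.ι K) := by
    intro H
    rw [← Submodule.map_comp, ← Submodule.map_comp]
    congr 1
    ext x
    simp [φ]
  have hmul : ∀ A B : Submodule K (ExteriorAlgebra K V), (A * B).map φ.toLinearMap =
      A.map φ.toLinearMap * B.map φ.toLinearMap := fun A B => Submodule.map_mul A B φ.toAlgHom
  have hpow : ∀ (A : Submodule K (ExteriorAlgebra K V)) (n : ℕ), (A ^ n).map φ.toLinearMap =
      A.map φ.toLinearMap ^ n := fun A n => Submodule.map_pow A φ.toAlgHom n
  have htop : (⊤ : Submodule K (ExteriorAlgebra K V)).map φ.toLinearMap = ⊤ := by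
    rw [Submodule.map_top]
    exact LinearMap.range_eq_top.2 φ.surjective
  have hI : ∀ i, (extIdeal (K := K) (v i) ^ 2).map φ.toLinearMap = extIdeal (K := K) (w i) ^ 2 := by
    intro i
    rw [hpow, extIdeal, extIdeal, hmul, hmul, htop, span_range_ι, span_range_ι, hφ, hg]
  have hd : (⋀[K]^d V).map φ.toLinearMap = ⋀[K]^d V := by
    rw [ExteriorAlgebra.exteriorPower, hpow, LinearMap.range_eq_map, hφ]
    simp
  have hW : (squaresPart (K := K) v d).map φ.toLinearMap = squaresPart (K := K) w d := by
    rw [squaresPart, squaresPart, Submodule.map_inf _ φ.injective, hd,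
      Submodule.map_iInf _ φ.injective]
    simp_rw [hI]
  rw [← hW]
  exact LinearEquiv.finrank_map_eq φ.toLinearEquiv _

end Squares

/-! ### Duality between the squares and the tangent spaces -/

section Duality

variable (K : Type*) [Field K]

/-- The basis of the exterior algebra of `K⁹` formed by the products of standard basis vectors. -/
def extBasis : Module.Basis (Finset (Fin 9)) K (ExteriorAlgebra K (Fin 9 → K)) :=
  (Pi.basisFun K (Fin 9)).ExteriorAlgebra

/-- The coefficient of `e₁ ∧ ⋯ ∧ e₉`. -/
def topCoord : ExteriorAlgebra K (Fin 9 → K) →ₗ[K] K := (extBasis K).coord Finset.univ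

/-- The form `z ↦ topCoord (ω z)` on `⋀³` that an element `ω` of the exterior algebra defines. -/
def wedgePairing : ExteriorAlgebra K (Fin 9 → K) →ₗ[K] Module.Dual K (⋀[K]^3 (Fin 9 → K)) :=
  (LinearMap.mul K _).compr₂ (topCoord K) |>.compl₂ (Submodule.subtype _)

theorem wedgePairing_apply (ω : ExteriorAlgebra K (Fin 9 → K)) (z : ⋀[K]^3 (Fin 9 → K)) :
    wedgePairing K ω z = topCoord K (ω * (z : ExteriorAlgebra K (Fin 9 → K))) := rfl

/-- The pairing is nondegenerate on `⋀⁶`: complementary sets of basis vectors are dual. -/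
theorem eq_zero_of_wedgePairing_eq_zero {ω : ExteriorAlgebra K (Fin 9 → K)}
    (hω : ω ∈ ⋀[K]^6 (Fin 9 → K)) (h : wedgePairing K ω = 0) : ω = 0 := by
  classical
  let b := (Pi.basisFun K (Fin 9)).exteriorPower 6
  have hcoe : ∀ R : Set.powersetCard (Fin 9) 6, (b R : ExteriorAlgebra K (Fin 9 → K)) =
      extBasis K R := fun R => (ExteriorAlgebra.basis_eq_coe_basis _ R).symm
  have hcoe3 : ∀ S : Set.powersetCard (Fin 9) 3,
      (((Pi.basisFun K (Fin 9)).exteriorPower 3 S : ⋀[K]^3 (Fin 9 → K)) :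
        ExteriorAlgebra K (Fin 9 → K)) =
      extBasis K S := fun R => (ExteriorAlgebra.basis_eq_coe_basis _ R).symm
  suffices (⟨ω, hω⟩ : ⋀[K]^6 (Fin 9 → K)) = 0 from congrArg Subtype.val this
  refine b.ext_elem fun R => ?_
  rw [map_zero, Finsupp.zero_apply]
  let S : Set.powersetCard (Fin 9) 3 := ⟨(R : Finset (Fin 9))ᶜ, by
    rw [Set.powersetCard.mem_iff, Finset.card_compl, Set.powersetCard.card_eq R]
    rfl⟩
  have hdisj : Disjoint R.val S.val := disjoint_compl_right
  have h1 := LinearMap.congr_fun h ((Pi.basisFun K (Fin 9)).exteriorPower 3 S)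
  rw [wedgePairing_apply, hcoe3] at h1
  have h2 : ω = ∑ Q, b.repr ⟨ω, hω⟩ Q • extBasis K Q := by
    have := congrArg Subtype.val (b.sum_repr ⟨ω, hω⟩)
    simp only [AddSubmonoidClass.coe_finsetSum, Submodule.coe_smul, hcoe] at this
    exact this.symm
  rw [h2, Finset.sum_mul, map_sum, Finset.sum_eq_single R] at h1
  · have huniv : (Set.powersetCard.disjUnion hdisj).val = Finset.univ := by
      apply Finset.eq_univ_of_card
      rw [Set.powersetCard.card_eq]
      rfl
    rw [smul_mul_assoc, map_smul, extBasis, ExteriorAlgebra.basis_mul_of_disjoint _ R S hdisj] at h1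
    have h3 : topCoord K ((Pi.basisFun K (Fin 9)).ExteriorAlgebra
        (Set.powersetCard.disjUnion hdisj).val) = 1 := by
      rw [huniv]
      simp [topCoord, extBasis]
    rcases Int.units_eq_one_or (Set.powersetCard.permOfDisjoint hdisj).sign with hs | hs
    · rw [hs, one_smul, h3] at h1
      simpa using h1
    · rw [hs, Units.neg_smul, one_smul, map_neg, h3] at h1
      simpa using h1
  · intro Q _ hQ
    rw [smul_mul_assoc, extBasis, ExteriorAlgebra.basis_mul_of_not_disjoint, smul_zero, map_zero]
    intro hd
    apply hQ
    rw [Set.powersetCard.eq_iff_subset]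
    intro i hi
    by_contra hi'
    exact Finset.disjoint_left.1 hd hi (Finset.mem_compl.2 hi')
  · simp

theorem topCoord_ιMulti_ne_zero {v : Fin 9 → Fin 9 → K} (hv : LinearIndependent K v) :
    topCoord K (ExteriorAlgebra.ιMulti K 9 v) ≠ 0 := by
  classical
  let f := (topCoord K).compAlternatingMap (ExteriorAlgebra.ιMulti K (M := Fin 9 → K) 9)
  let b := basisOfLinearIndependentOfCardEqFinrank hv (by simp)
  have h1 : f ≠ 0 := by
    intro h0
    have h2 : topCoord K (extBasis K Finset.univ) = 1 := by simp [topCoord]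
    rw [extBasis, ExteriorAlgebra.basis_apply_ofCard (n := 9) _ (by simp)] at h2
    have h3 := congrArg (fun g => g ((Pi.basisFun K (Fin 9)) ∘ (Set.powersetCard.ofFinEmbEquiv.symm
      (Set.powersetCard.ofCard (n := 9) (s := (Finset.univ : Finset (Fin 9))) (by simp))))) h0
    exact one_ne_zero (h2.symm.trans h3)
  have h4 := (AlternatingMap.map_basis_ne_zero_iff b f).2 h1
  rwa [coe_basisOfLinearIndependentOfCardEqFinrank] at h4

/-- An alternating map that vanishes when one argument lies in `N` depends on its arguments
only modulo `N`. -/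
theorem alternatingMap_congr {V N : Type*} [AddCommGroup V] [Module K V] [AddCommGroup N]
    [Module K N] {n : ℕ} (f : V [⋀^Fin n]→ₗ[K] N) {U : Submodule K V}
    (hf : ∀ u i, u i ∈ U → f u = 0) {v w : Fin n → V} (h : ∀ i, v i - w i ∈ U) : f v = f w := by
  have h1 : v = w + fun i => v i - w i := by ext1 i; simp
  have h2 := f.toMultilinearMap.map_add_univ w fun i => v i - w i
  rw [← h1] at h2
  refine h2.trans ?_
  rw [Finset.sum_eq_single Finset.univ]
  · simp
  · intro s _ hs
    obtain ⟨i, hi⟩ : ∃ i, i ∉ s := by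
      by_contra! h0
      exact hs (Finset.eq_univ_of_forall h0)
    exact hf _ i (by rw [Finset.piecewise_eq_of_notMem _ _ _ hi]; exact h i)
  · simp

/-- The vectors `e_{k,0} - q₀ e_{k,2}` and `e_{k,1} - q₁ e_{k,2}`, which span the kernel of the
linear form `(q₀, q₁, 1)` on each block. -/
def kerVec (q : Fin 2 → K) : Fin 6 → Fin 9 → K :=
  ![e K (blk 0 0) - q 0 • e K (blk 0 2), e K (blk 0 1) - q 1 • e K (blk 0 2),
    e K (blk 1 0) - q 0 • e K (blk 1 2), e K (blk 1 1) - q 1 • e K (blk 1 2),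
    e K (blk 2 0) - q 0 • e K (blk 2 2), e K (blk 2 1) - q 1 • e K (blk 2 2)]

theorem ιMulti_six {V : Type*} [AddCommGroup V] [Module K V] (u : Fin 6 → V) :
    ExteriorAlgebra.ιMulti K 6 u =
      ExteriorAlgebra.ι K (u 0) * ExteriorAlgebra.ι K (u 1) *
        (ExteriorAlgebra.ι K (u 2) * ExteriorAlgebra.ι K (u 3)) *
          (ExteriorAlgebra.ι K (u 4) * ExteriorAlgebra.ι K (u 5)) := by
  rw [ExteriorAlgebra.ιMulti_apply]
  simp only [List.ofFn_succ, List.ofFn_zero, List.prod_cons, List.prod_nil, mul_one, mul_assoc]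
  rfl

/-- The product of the vectors `kerVec K q` lies in the square of the fourth ideal because two of
its factors can be replaced by vectors of the fourth subspace. -/
theorem ιMulti_kerVec_mem (q : Fin 2 → K) :
    ExteriorAlgebra.ιMulti K 6 (kerVec K q) ∈ squaresPart (K := K) (normalForm K) 6 := by
  refine ⟨(Submodule.mem_iInf _).2 fun j => ?_, ExteriorAlgebra.ιMulti_range K 6 ⟨_, rfl⟩⟩
  have hmem : ∀ k a b c, e K (blk k a) - c • e K (blk k b) ∈
      Submodule.span K (Set.range (normalForm K k.castSucc)) := fun k a b c =>
    sub_mem (e_blk_mem_span K k a) (Submodule.smul_mem _ _ (e_blk_mem_span K k b))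
  have h4 : ∀ a, (∑ k, e K (blk k a)) ∈ Submodule.span K (Set.range (normalForm K 3)) :=
    fun a => Submodule.subset_span ⟨a, normalForm_three K a⟩
  fin_cases j
  · rw [ιMulti_six]
    have := mul_mem_extIdeal_sq (hmem 0 0 2 (q 0)) (hmem 0 1 2 (q 1)) 1
      (ExteriorAlgebra.ι K (kerVec K q 2) * ExteriorAlgebra.ι K (kerVec K q 3) *
        (ExteriorAlgebra.ι K (kerVec K q 4) * ExteriorAlgebra.ι K (kerVec K q 5)))
    rw [one_mul, ← mul_assoc] at this
    exact this
  · rw [ιMulti_six]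
    exact mul_mem_extIdeal_sq (hmem 1 0 2 (q 0)) (hmem 1 1 2 (q 1))
      (ExteriorAlgebra.ι K (kerVec K q 0) * ExteriorAlgebra.ι K (kerVec K q 1))
      (ExteriorAlgebra.ι K (kerVec K q 4) * ExteriorAlgebra.ι K (kerVec K q 5))
  · rw [ιMulti_six]
    have := mul_mem_extIdeal_sq (hmem 2 0 2 (q 0)) (hmem 2 1 2 (q 1))
      (ExteriorAlgebra.ι K (kerVec K q 0) * ExteriorAlgebra.ι K (kerVec K q 1) *
        (ExteriorAlgebra.ι K (kerVec K q 2) * ExteriorAlgebra.ι K (kerVec K q 3))) 1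
    rw [mul_one] at this
    exact this
  · -- adding the first two pairs of vectors to the third one puts that pair into the fourth
    -- subspace
    let u := kerVec K q
    have h5 : ExteriorAlgebra.ιMulti K 6 (Function.update (Function.update u 4 (u 0 + u 2 + u 4))
        5 (u 1 + u 3 + u 5)) = ExteriorAlgebra.ιMulti K 6 u := by
      have hself : ∀ (u : Fin 6 → Fin 9 → K) (i j : Fin 6), i ≠ j →
          ExteriorAlgebra.ιMulti K 6 (Function.update u i (u j)) = 0 :=
        fun u i j hij => AlternatingMap.map_update_self _ _ hij
      have h6 := hself (Function.update u 4 (u 0 + u 2 + u 4)) 5 1 (by decide)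
      have h7 := hself (Function.update u 4 (u 0 + u 2 + u 4)) 5 3 (by decide)
      have h8 : Function.update (Function.update u 4 (u 0 + u 2 + u 4)) 5 (u 5) =
          Function.update u 4 (u 0 + u 2 + u 4) := by
        rw [Function.update_comm (by decide), Function.update_eq_self]
      rw [Function.update_of_ne (by decide)] at h6 h7
      rw [AlternatingMap.map_update_add, AlternatingMap.map_update_add, h6, h7, h8, zero_add,
        zero_add, AlternatingMap.map_update_add, AlternatingMap.map_update_add,
        hself u 4 0 (by decide), hself u 4 2 (by decide), Function.update_eq_self, zero_add,
        zero_add]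
    change ExteriorAlgebra.ιMulti K 6 u ∈ _
    have hx : u 0 + u 2 + u 4 = ∑ k, e K (blk k 0) - q 0 • ∑ k, e K (blk k 2) := by
      simp only [u, kerVec, Fin.sum_univ_three, smul_add]
      simp
      abel
    have hy : u 1 + u 3 + u 5 = ∑ k, e K (blk k 1) - q 1 • ∑ k, e K (blk k 2) := by
      simp only [u, kerVec, Fin.sum_univ_three, smul_add]
      simp
      abel
    rw [← h5, ιMulti_six, Function.update_self, Function.update_of_ne (a := 4) (by decide),
      Function.update_self, hx, hy]
    have := mul_mem_extIdeal_sq (sub_mem (h4 0) (Submodule.smul_mem _ (q 0) (h4 2)))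
      (sub_mem (h4 1) (Submodule.smul_mem _ (q 1) (h4 2)))
    rw [← mul_one (_ * _)]
    exact this _ _

/-- Multiplication by the product of the vectors `kerVec K q` only sees the values of the blocks
at `(q₀, q₁, 1)`. -/
theorem wedgePairing_kerVec (q : Fin 2 → K) (z : ⋀[K]^3 (Fin 9 → K)) :
    wedgePairing K (ExteriorAlgebra.ιMulti K 6 (kerVec K q)) z =
      topCoord K (ExteriorAlgebra.ιMulti K 6 (kerVec K q) *
        ExteriorAlgebra.ιMulti K 3 (transversal K fun _ => 2)) *
      MvPolynomial.eval ![q 0, q 1, 1] (cubicMap K z) := by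
  have hz : z ∈ Submodule.span K (Set.range (exteriorPower.ιMulti K 3 (M := Fin 9 → K))) := by
    rw [exteriorPower.ιMulti_span]; trivial
  induction hz using Submodule.span_induction with
  | zero => simp
  | add x y _ _ hx hy => rw [map_add, map_add, map_add, hx, hy, mul_add]
  | smul c x _ hx =>
    rw [map_smul, map_smul, MvPolynomial.smul_eval, hx, smul_eq_mul]
    ring
  | mem z hz =>
    obtain ⟨v, rfl⟩ := hz
    let A : (Fin 9 → K) [⋀^Fin 3]→ₗ[K] ExteriorAlgebra K (Fin 9 → K) :=
      (LinearMap.mulLeft K (ExteriorAlgebra.ιMulti K 6 (kerVec K q))).compAlternatingMap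
        (ExteriorAlgebra.ιMulti K 3)
    have hA : ∀ u i, u i ∈ Submodule.span K (Set.range (kerVec K q)) → A u = 0 := by
      intro u i hi
      have h1 : Submodule.span K (Set.range (kerVec K q)) ≤
          LinearMap.ker (A.toMultilinearMap.toLinearMap u i) := by
        rw [Submodule.span_le]
        rintro _ ⟨m, rfl⟩
        change ExteriorAlgebra.ιMulti K 6 (kerVec K q) *
          ExteriorAlgebra.ιMulti K 3 (Function.update u i (kerVec K q m)) = 0
        rw [ExteriorAlgebra.ιMulti_mul_ιMulti]
        refine AlternatingMap.map_eq_zero_of_eq _ _ (i := Fin.castAdd 3 m) (j := Fin.natAdd 6 i)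
          (by simp) ?_
        rw [Ne, Fin.ext_iff, Fin.val_castAdd, Fin.val_natAdd]
        omega
      have h2 : A (Function.update u i (u i)) = 0 := h1 hi
      rwa [Function.update_eq_self] at h2
    let ℓ : Matrix (Fin 3) (Fin 3) K :=
      Matrix.of fun i k => MvPolynomial.eval ![q 0, q 1, 1] (block K k (v i))
    let ψ : (Fin 3 → K) →ₗ[K] (Fin 9 → K) :=
      Fintype.linearCombination K (transversal K fun _ => 2)
    -- modulo `kerVec`, each block of `v i` is a multiple of the last basis vector of that block
    have h1 : A v = A fun i => ψ (ℓ i) := by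
      refine alternatingMap_congr K A hA fun i => ?_
      have h2 : v i - ψ (ℓ i) = ∑ m : Fin 6, ![v i 0, v i 1, v i 3, v i 4, v i 6, v i 7] m •
          kerVec K q m := by
        funext s
        simp only [ψ, Fintype.linearCombination_apply, Fin.sum_univ_six, Fin.sum_univ_three,
          Pi.sub_apply, Pi.add_apply, Pi.smul_apply, smul_eq_mul, ℓ, Matrix.of_apply, block,
          LinearMap.coe_mk, AddHom.coe_mk, map_add, MvPolynomial.smul_eval, MvPolynomial.eval_X,
          transversal, kerVec, e, blk]
        fin_cases s <;> simp <;> ring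
      rw [h2]
      exact Submodule.sum_mem _ fun m _ => Submodule.smul_mem _ _ (Submodule.subset_span ⟨m, rfl⟩)
    have h3 : topCoord K (A fun i => ψ (ℓ i)) =
        topCoord K (A (transversal K fun _ => 2)) * ℓ.det := by
      have h4 := congrArg (fun f => f ℓ) ((((topCoord K).compAlternatingMap A).compLinearMap
        ψ).eq_smul_basis_det (Pi.basisFun K (Fin 3)))
      have h6 : (fun k => ψ (Pi.basisFun K (Fin 3) k)) = transversal K fun _ => 2 := by
        funext k
        simp [ψ, Fintype.linearCombination_apply]
      rw [← h6]
      refine h4.trans ?_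
      exact congrArg (_ * ·) (Pi.basisFun_det_apply ℓ)
    have h5 : MvPolynomial.eval ![q 0, q 1, 1] (cubicMap K (exteriorPower.ιMulti K 3 v)) =
        ℓ.det := by
      rw [cubicMap_ιMulti, RingHom.map_det]
      rfl
    rw [h5]
    exact (congrArg (topCoord K) h1).trans h3

/-- The six vectors `kerVec K q` and the last vectors of the three blocks form a basis of `K⁹`. -/
theorem topCoord_kerVec_ne_zero (q : Fin 2 → K) :
    topCoord K (ExteriorAlgebra.ιMulti K 6 (kerVec K q) *
        ExteriorAlgebra.ιMulti K 3 (transversal K fun _ => 2)) ≠ 0 := by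
  rw [ExteriorAlgebra.ιMulti_mul_ιMulti]
  apply topCoord_ιMulti_ne_zero
  refine linearIndependent_of_top_le_span_of_card_eq_finrank ?_ (by simp)
  set N := Submodule.span K (Set.range (Fin.append (kerVec K q) (transversal K fun _ => 2)))
  have hk : ∀ m, kerVec K q m ∈ N := fun m =>
    Submodule.subset_span ⟨Fin.castAdd 3 m, Fin.append_left _ _ m⟩
  have h2 : ∀ k, e K (blk k 2) ∈ N := fun k =>
    Submodule.subset_span ⟨Fin.natAdd 6 k, Fin.append_right _ _ k⟩
  have h3 : ∀ (x : Fin 9 → K) (c : K) k, x - c • e K (blk k 2) ∈ N → x ∈ N := fun x c k hx => by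
    simpa using add_mem hx (Submodule.smul_mem _ c (h2 k))
  rw [← (Pi.basisFun K (Fin 9)).span_eq, Submodule.span_le]
  rintro _ ⟨i, rfl⟩
  rw [Pi.basisFun_apply]
  change e K i ∈ N
  fin_cases i
  · exact h3 _ _ 0 (hk 0)
  · exact h3 _ _ 0 (hk 1)
  · exact h2 0
  · exact h3 _ _ 1 (hk 2)
  · exact h3 _ _ 1 (hk 3)
  · exact h2 1
  · exact h3 _ _ 2 (hk 4)
  · exact h3 _ _ 2 (hk 5)
  · exact h2 2

theorem isHomogeneous_cubicMap (z : ⋀[K]^3 (Fin 9 → K)) : (cubicMap K z).IsHomogeneous 3 := by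
  have hz : z ∈ Submodule.span K (Set.range (exteriorPower.ιMulti K 3 (M := Fin 9 → K))) := by
    rw [exteriorPower.ιMulti_span]; trivial
  induction hz using Submodule.span_induction with
  | zero => rw [map_zero]; exact MvPolynomial.isHomogeneous_zero _ _ _
  | add x y _ _ hx hy => rw [map_add]; exact hx.add hy
  | smul c x _ hx =>
    rw [map_smul, MvPolynomial.smul_eq_C_mul]
    simpa using (MvPolynomial.isHomogeneous_C _ c).mul hx
  | mem x hx =>
    obtain ⟨v, rfl⟩ := hx
    have hb : ∀ i k, (block K k (v i)).IsHomogeneous 1 := by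
      intro i k
      refine MvPolynomial.IsHomogeneous.sum _ _ _ fun a _ => ?_
      rw [MvPolynomial.smul_eq_C_mul]
      simpa using (MvPolynomial.isHomogeneous_C _ _).mul (MvPolynomial.isHomogeneous_X K a)
    rw [cubicMap_ιMulti]
    exact isHomogeneous_det_fin_three hb

/-- A cubic form is determined by its values at the points `(q₀, q₁, 1)`. -/
theorem cubicMap_eq_zero [Infinite K] {z : ⋀[K]^3 (Fin 9 → K)}
    (h : ∀ q : Fin 2 → K, MvPolynomial.eval ![q 0, q 1, 1] (cubicMap K z) = 0) :
    cubicMap K z = 0 := by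
  suffices H : MvPolynomial.X 2 * cubicMap K z = 0 from
    (mul_eq_zero.1 H).resolve_left (MvPolynomial.X_ne_zero 2)
  refine MvPolynomial.funext fun t => ?_
  rw [map_mul, MvPolynomial.eval_X, map_zero]
  by_cases ht : t 2 = 0
  · rw [ht, zero_mul]
  have h1 := h ![t 0 / t 2, t 1 / t 2]
  have h2 : t = fun i => t 2 * (![t 0 / t 2, t 1 / t 2, 1] : Fin 3 → K) i := by
    funext i
    fin_cases i <;> simp [mul_div_cancel₀, ht]
  rw [h2, eval_smul_of_isHomogeneous (isHomogeneous_cubicMap K z)]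
  simp only [Matrix.cons_val_zero, Matrix.cons_val_one] at h1
  rw [h1, mul_zero, mul_zero]

/-- The degree six part of the intersection of the squares is dual to the quotient of `⋀³` by the
sum of the tangent spaces. -/
theorem finrank_squaresPart_normalForm [Infinite K] :
    Module.finrank K (squaresPart (K := K) (normalForm K) 6) = 10 := by
  let W := squaresPart (K := K) (normalForm K) 6
  let β := (wedgePairing K).comp W.subtype
  have hinj : Function.Injective β := by
    rw [injective_iff_map_eq_zero]
    intro ω hω
    exact Subtype.ext (eq_zero_of_wedgePairing_eq_zero K ω.2.2 hω)
  have hcoann : (LinearMap.range β).dualCoannihilator = sumTangentSpace K (normalForm K) := by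
    apply le_antisymm
    · intro z hz
      rw [sumTangentSpace_eq_ker_cubicMap, LinearMap.mem_ker]
      apply cubicMap_eq_zero
      intro q
      have h1 := (Submodule.mem_dualCoannihilator z).1 hz _ ⟨⟨_, ιMulti_kerVec_mem K q⟩, rfl⟩
      have h2 := (wedgePairing_kerVec K q z).symm.trans h1
      exact (mul_eq_zero.1 h2).resolve_left (topCoord_kerVec_ne_zero K q)
    · refine iSup_le fun j z hz => (Submodule.mem_dualCoannihilator z).2 ?_
      rintro _ ⟨ω, rfl⟩
      have h1 : (ω : ExteriorAlgebra K (Fin 9 → K)) ∈ extIdeal (K := K) (normalForm K j) ^ 2 :=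
        (Submodule.mem_iInf _).1 ω.2.1 j
      have h2 := mul_ιMulti_eq_zero h1 hz
      change topCoord K (ω * (z : ExteriorAlgebra K (Fin 9 → K))) = 0
      rw [h2, map_zero]
  have h1 := Subspace.finrank_add_finrank_dualCoannihilator_eq (LinearMap.range β)
  rw [hcoann, finrank_sumTangentSpace, finrank_exteriorPower, LinearMap.finrank_range_of_inj hinj]
    at h1
  change Module.finrank K W = 10
  omega

end Duality

/-! ### Four generic subspaces -/

section Generic

open MvPolynomial

variable (K : Type*) [Field K]

/-- The nine vectors of the three triples other than the `i`-th one. -/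
def omitFamily {V : Type*} (v : Fin 4 → Fin 3 → V) (i : Fin 4) (p : Fin 3 × Fin 3) : V :=
  v (i.succAbove p.1) p.2

/-- The coordinate matrix of nine vectors, with coordinates indexed by blocks. -/
def genericMatrix (i : Fin 4) :
    Matrix (Fin 3 × Fin 3) (Fin 3 × Fin 3) (MvPolynomial (Fin 4 × Fin 3 × Fin 9) K) :=
  Matrix.of fun p q => X (i.succAbove p.1, p.2, blk q.1 q.2)

/-- The product of the four determinants formed by three of the four triples of vectors. -/
def genericPolynomial : MvPolynomial (Fin 4 × Fin 3 × Fin 9) K := ∏ i, (genericMatrix K i).det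

variable {K}

theorem eval_det_genericMatrix (v : Fin 4 → Fin 3 → Fin 9 → K) (i : Fin 4) :
    eval (fun t => v t.1 t.2.1 t.2.2) (genericMatrix K i).det =
      (Matrix.of fun p q : Fin 3 × Fin 3 => omitFamily v i p (blk q.1 q.2)).det := by
  rw [RingHom.map_det]
  congr 1
  ext p q
  simp [genericMatrix, omitFamily]

theorem linearIndependent_omitFamily {v : Fin 4 → Fin 3 → Fin 9 → K}
    (hv : eval (fun t => v t.1 t.2.1 t.2.2) (genericPolynomial K) ≠ 0) (i : Fin 4) :
    LinearIndependent K (omitFamily v i) := by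
  rw [genericPolynomial, map_prod, Finset.prod_ne_zero_iff] at hv
  have h1 := hv i (Finset.mem_univ i)
  rw [eval_det_genericMatrix] at h1
  have h2 := Matrix.linearIndependent_rows_of_det_ne_zero h1
  exact LinearIndependent.of_comp (LinearMap.funLeft K K fun q : Fin 3 × Fin 3 => blk q.1 q.2) h2

theorem linearIndependent_of_genericPolynomial {v : Fin 4 → Fin 3 → Fin 9 → K}
    (hv : eval (fun t => v t.1 t.2.1 t.2.2) (genericPolynomial K) ≠ 0) (j : Fin 4) :
    LinearIndependent K (v j) := by
  obtain ⟨i, k, rfl⟩ : ∃ (i : Fin 4) (k : Fin 3), i.succAbove k = j := by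
    revert j; decide
  exact (linearIndependent_omitFamily hv i).comp (fun a => (k, a)) fun a b h => by simpa using h

/-- At the normal form, each of the determinants is a Kronecker product of a minor of the matrix
`coeffVec` with the identity matrix. -/
theorem eval_normalForm_genericPolynomial_ne_zero :
    eval (fun t => normalForm K t.1 t.2.1 t.2.2) (genericPolynomial K) ≠ 0 := by
  rw [genericPolynomial, map_prod, Finset.prod_ne_zero_iff]
  intro i _
  rw [eval_det_genericMatrix]
  have h1 : (Matrix.of fun p q : Fin 3 × Fin 3 => omitFamily (normalForm K) i p (blk q.1 q.2)) =
      Matrix.kroneckerMap (· * ·) (Matrix.of fun r k => coeffVec K (i.succAbove r) k)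
        (1 : Matrix (Fin 3) (Fin 3) K) := by
    ext ⟨r, a⟩ ⟨k, b⟩
    simp only [omitFamily, Matrix.of_apply, normalForm_eq, Finset.sum_apply, Pi.smul_apply, e,
      Pi.single_apply, blk_eq_blk_iff, Matrix.kroneckerMap_apply, Matrix.one_apply, smul_eq_mul]
    by_cases hab : a = b
    · simp [hab]
    · simp [hab, Ne.symm hab]
  rw [h1, Matrix.det_kronecker, Matrix.det_one, one_pow, mul_one]
  apply pow_ne_zero
  fin_cases i <;> simp [Matrix.det_fin_three, coeffVec, Fin.succAbove, Fin.lt_def]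

theorem genericPolynomial_ne_zero : genericPolynomial K ≠ 0 := by
  intro h
  apply eval_normalForm_genericPolynomial_ne_zero (K := K)
  rw [h, map_zero]

/-- Four general three-dimensional subspaces are equivalent to the normal form: decompose the
vectors of the fourth subspace along the first three, which gives new bases of these. -/
theorem exists_linearEquiv_normalForm {v : Fin 4 → Fin 3 → Fin 9 → K}
    (hv : eval (fun t => v t.1 t.2.1 t.2.2) (genericPolynomial K) ≠ 0) :
    ∃ g : (Fin 9 → K) ≃ₗ[K] (Fin 9 → K), ∀ i,
      (Submodule.span K (Set.range (normalForm K i))).map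
        (g : (Fin 9 → K) →ₗ[K] (Fin 9 → K)) = Submodule.span K (Set.range (v i)) := by
  have hcard : Fintype.card (Fin 3 × Fin 3) = Module.finrank K (Fin 9 → K) := by simp
  have hspan : ∀ i, Submodule.span K (Set.range (omitFamily v i)) = ⊤ := fun i =>
    (linearIndependent_omitFamily hv i).span_eq_top_of_card_eq_finrank' hcard
  let B := basisOfLinearIndependentOfCardEqFinrank (linearIndependent_omitFamily hv 3) hcard
  have hB : ∀ k b, B (k, b) = v k.castSucc b := by
    intro k b
    have h3 : ∀ k : Fin 3, (3 : Fin 4).succAbove k = k.castSucc := by decide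
    simp only [B, coe_basisOfLinearIndependentOfCardEqFinrank, omitFamily, h3]
  -- the projections to the first three subspaces
  let π : Fin 3 → (Fin 9 → K) →ₗ[K] (Fin 9 → K) := fun k =>
    B.constr K fun p => if p.1 = k then B p else 0
  have hπ : ∀ k l b, π k (v l.castSucc b) = if l = k then v l.castSucc b else 0 := by
    intro k l b
    rw [← hB]
    exact B.constr_basis K _ _
  have hsum : ∀ w, ∑ k, π k w = w := by
    intro w
    have : ∑ k, π k = LinearMap.id := by
      refine B.ext fun p => ?_
      have hp : ∀ k, π k (B p) = if p.1 = k then B p else 0 := fun k => B.constr_basis K _ p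
      simp [hp]
    simpa using LinearMap.congr_fun this w
  let x : Fin 3 → Fin 3 → Fin 9 → K := fun k a => π k (v 3 a)
  have hx : ∀ k, Submodule.span K (Set.range (x k)) =
      Submodule.span K (Set.range (v k.castSucc)) := by
    intro k
    apply le_antisymm
    · rw [Submodule.span_le]
      rintro _ ⟨a, rfl⟩
      have h1 : LinearMap.range (π k) ≤ Submodule.span K (Set.range (v k.castSucc)) := by
        rw [LinearMap.range_eq_map, ← B.span_eq, Submodule.map_span, Submodule.span_le]
        rintro _ ⟨_, ⟨⟨l, b⟩, rfl⟩, rfl⟩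
        rw [hB, hπ]
        split_ifs with h
        · rw [h]
          exact Submodule.subset_span ⟨b, rfl⟩
        · exact zero_mem _
      exact h1 ⟨_, rfl⟩
    · -- the other two subspaces and the fourth one span everything, and `π k` kills the former
      have h1 : (⊤ : Submodule K (Fin 9 → K)).map (π k) ≤ Submodule.span K (Set.range (x k)) := by
        rw [← hspan k.castSucc, Submodule.map_span, Submodule.span_le]
        rintro _ ⟨_, ⟨⟨r, b⟩, rfl⟩, rfl⟩
        have hne := Fin.succAbove_ne k.castSucc r
        have hcases : ∀ j : Fin 4, j = 3 ∨ ∃ l : Fin 3, j = l.castSucc := by decide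
        rw [omitFamily]
        rcases hcases (k.castSucc.succAbove r) with h | ⟨l, h⟩
        · simp only [h]
          exact Submodule.subset_span ⟨b, rfl⟩
        · simp only [h] at hne ⊢
          rw [hπ, if_neg (fun hlk => hne (by rw [hlk]))]
          exact zero_mem _
      rw [Submodule.span_le]
      rintro _ ⟨b, rfl⟩
      have h2 := hπ k k b
      rw [if_pos rfl] at h2
      exact h1 ⟨_, trivial, h2⟩
  -- the map carrying the standard basis to the new bases of the first three subspaces
  let L : (Fin 9 → K) →ₗ[K] (Fin 9 → K) :=
    { toFun := fun w => ∑ k, ∑ a, w (blk k a) • x k a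
      map_add' := fun w w' => by simp [add_smul, Finset.sum_add_distrib]
      map_smul' := fun c w => by simp [Finset.smul_sum, mul_smul] }
  have hL : ∀ k a, L (e K (blk k a)) = x k a := by
    intro k a
    simp only [L, LinearMap.coe_mk, AddHom.coe_mk, e, Pi.single_apply, blk_eq_blk_iff,
      ite_smul, one_smul, zero_smul]
    rw [Finset.sum_eq_single k (by intro l _ hl; simp [hl]) (by simp)]
    simp
  have hsurj : Function.Surjective L := by
    rw [← LinearMap.range_eq_top, eq_top_iff, ← B.span_eq, Submodule.span_le]
    rintro _ ⟨⟨k, b⟩, rfl⟩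
    rw [hB]
    have h1 : Submodule.span K (Set.range (x k)) ≤ LinearMap.range L := by
      rw [Submodule.span_le]
      rintro _ ⟨a, rfl⟩
      exact ⟨_, hL k a⟩
    apply h1
    rw [hx]
    exact Submodule.subset_span ⟨b, rfl⟩
  refine ⟨LinearEquiv.ofBijective L ⟨LinearMap.injective_iff_surjective.2 hsurj, hsurj⟩,
    fun i => ?_⟩
  have hcases : ∀ j : Fin 4, j = 3 ∨ ∃ l : Fin 3, j = l.castSucc := by decide
  rw [Submodule.map_span, ← Set.range_comp]
  have hval : ∀ i a, L (normalForm K i a) = ∑ k, coeffVec K i k • x k a := by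
    intro i a
    rw [normalForm_eq, map_sum]
    exact Finset.sum_congr rfl fun k _ => by rw [map_smul, hL]
  rcases hcases i with rfl | ⟨l, rfl⟩
  · congr 2
    funext a
    refine (hval 3 a).trans ?_
    rw [← hsum (v 3 a)]
    exact Finset.sum_congr rfl fun k _ => by fin_cases k <;> simp [coeffVec, x]
  · rw [← hx]
    congr 2
    funext a
    refine (hval l.castSucc a).trans ?_
    rw [Finset.sum_eq_single l]
    · fin_cases l <;> simp [coeffVec]
    · intro b _ hb
      revert hb
      fin_cases l <;> fin_cases b <;> simp [coeffVec]
    · simp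

end Generic

/-! ### Dimensions of the Grassmannian and of its fourth secant variety -/

section Parametrization

open MvPolynomial

variable {K : Type*} [Field K]

theorem ιMulti_ne_zero {V : Type*} [AddCommGroup V] [Module K V] {v : Fin 3 → V}
    (hv : LinearIndependent K v) : exteriorPower.ιMulti K 3 v ≠ 0 := by
  intro h0
  have h1 := exteriorPower.ιMulti_family_linearIndependent_field (n := 3) hv
  let S : Set.powersetCard (Fin 3) 3 := ⟨Finset.univ, by simp⟩
  apply h1.ne_zero S
  let f := Set.powersetCard.ofFinEmbEquiv.symm S
  let σ : Equiv.Perm (Fin 3) := Equiv.ofBijective f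
    (Finite.injective_iff_bijective.1 f.injective)
  change exteriorPower.ιMulti K 3 (v ∘ σ) = 0
  rw [AlternatingMap.map_perm, h0, smul_zero]

theorem exists_pluckerSum_ne_zero (s : ℕ) [NeZero s] : ∃ S, pluckerSum K 9 s S ≠ 0 := by
  let S : Set.powersetCard (Fin 9) 3 := ⟨{0, 1, 2}, rfl⟩
  refine ⟨S, fun h0 => ?_⟩
  let v : Fin s → Fin 3 → Fin 9 → K := Pi.single 0
    fun k => Pi.single (Set.powersetCard.ofFinEmbEquiv.symm S k) 1
  have h1 := eval_pluckerSum v S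
  have hv0 : v 0 = fun k => Pi.single (Set.powersetCard.ofFinEmbEquiv.symm S k) 1 :=
    Pi.single_eq_same _ _
  rw [h0, map_zero, Finset.sum_eq_single 0, hv0, ← pluckerBasis_apply] at h1
  · simp at h1
  · intro j _ hj
    simp only [v, Pi.single_eq_of_ne hj]
    exact AlternatingMap.map_zero _
  · simp

/-- A vector of the third exterior power is determined by its Plücker coordinates. -/
theorem eq_sum_ιMulti {s : ℕ} {t : Fin s × Fin 3 × Fin 9 → K} {y : ⋀[K]^3 (Fin 9 → K)}
    (hy : ∀ S, (pluckerBasis K 3 9).repr y S = eval t (pluckerSum K 9 s S)) :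
    y = ∑ j, exteriorPower.ιMulti K 3 fun a i => t (j, a, i) :=
  (pluckerBasis K 3 9).ext_elem fun S => by
    rw [hy, ← eval_pluckerSum fun j a i => t (j, a, i)]

theorem linearIndependent_of_ιMulti_ne_zero {V : Type*} [AddCommGroup V] [Module K V]
    {v : Fin 3 → V} (hv : exteriorPower.ιMulti K 3 v ≠ 0) : LinearIndependent K v := by
  by_contra h
  exact hv (AlternatingMap.map_linearDependent _ _ h)

theorem smul_ιMulti {V : Type*} [AddCommGroup V] [Module K V] (c : K) (v : Fin 3 → V) :
    c • exteriorPower.ιMulti K 3 v =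
      exteriorPower.ιMulti K 3 (Function.update v 0 (c • v 0)) := by
  rw [AlternatingMap.map_update_smul, Function.update_eq_self]

/-- Scalar multiples are reached by scaling the first of the three vectors. -/
theorem isParametrizedBy_grassmannian (S : Set.powersetCard (Fin 9) 3)
    (hS : pluckerSum K 9 1 S ≠ 0) :
    IsParametrizedBy (pluckerBasis K 3 9) (pluckerGrassmannian K 3 9) (pluckerSum K 9 1)
      (pluckerSum K 9 1 S) where
  ne_zero := hS
  exists_homogeneous := ⟨3, by norm_num, isHomogeneous_pluckerSum 9 1⟩
  exists_ne_zero := ⟨S, hS⟩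
  mem t _ y hy0 hy := by
    have h1 := eq_sum_ιMulti hy
    rw [Fin.sum_univ_one] at h1
    refine ⟨_, linearIndependent_of_ιMulti_ne_zero (h1 ▸ hy0), ?_⟩
    rw [Projectivization.submodule_mk, ← h1]
  exists_eq := by
    rintro x ⟨v, -, hx⟩
    have h1 : x.rep ∈ x.submodule := by
      rw [Projectivization.submodule_eq]
      exact Submodule.mem_span_singleton_self _
    rw [hx, Submodule.mem_span_singleton] at h1
    obtain ⟨c, hc⟩ := h1
    refine ⟨fun t => Function.update v 0 (c • v 0) t.2.1 t.2.2, fun S => ?_⟩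
    rw [eval_pluckerSum fun _ : Fin 1 => Function.update v 0 (c • v 0), Fin.sum_univ_one,
      ← smul_ιMulti, hc]

/-- Where `genericPolynomial` does not vanish the four summands are points of the Grassmannian;
conversely the coefficients of a linear combination are absorbed by the first vectors. -/
theorem isParametrizedBy_spans :
    IsParametrizedBy (pluckerBasis K 3 9)
      {y | ∃ p : Fin 4 → ℙ K (⋀[K]^3 (Fin 9 → K)), (∀ i, p i ∈ pluckerGrassmannian K 3 9) ∧
        y.submodule ≤ ⨆ i, (p i).submodule}
      (pluckerSum K 9 4) (genericPolynomial K) where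
  ne_zero := genericPolynomial_ne_zero
  exists_homogeneous := ⟨3, by norm_num, isHomogeneous_pluckerSum 9 4⟩
  exists_ne_zero := exists_pluckerSum_ne_zero 4
  mem t ht y hy0 hy := by
    have h1 := eq_sum_ιMulti hy
    have hli : ∀ j, LinearIndependent K fun a i => t (j, a, i) :=
      linearIndependent_of_genericPolynomial (v := fun j a i => t (j, a, i)) ht
    refine ⟨fun j => Projectivization.mk K _ (ιMulti_ne_zero (hli j)), fun j => ⟨_, hli j, ?_⟩, ?_⟩
    · rw [Projectivization.submodule_mk]
    · rw [Projectivization.submodule_mk, Submodule.span_singleton_le_iff_mem, h1]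
      refine Submodule.sum_mem _ fun j _ => Submodule.mem_iSup_of_mem j ?_
      rw [Projectivization.submodule_mk]
      exact Submodule.mem_span_singleton_self _
  exists_eq := by
    rintro x ⟨p, hp, hx⟩
    choose v _ hv using hp
    have h1 : x.rep ∈ x.submodule := by
      rw [Projectivization.submodule_eq]
      exact Submodule.mem_span_singleton_self _
    have h2 := hx h1
    simp_rw [hv, ← Submodule.span_range_eq_iSup] at h2
    obtain ⟨c, hc⟩ := (Submodule.mem_span_range_iff_exists_fun K).1 h2
    refine ⟨fun t => Function.update (v t.1) 0 (c t.1 • v t.1 0) t.2.1 t.2.2, fun S => ?_⟩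
    rw [eval_pluckerSum fun j => Function.update (v j) 0 (c j • v j 0)]
    simp_rw [← smul_ιMulti]
    rw [hc]

variable (K) [CharZero K]

theorem hasDim_grassmannian :
    HasDim (pluckerBasis K 3 9) (pluckerGrassmannian K 3 9) 18 := by
  obtain ⟨S, hS⟩ := exists_pluckerSum_ne_zero (K := K) 1
  refine (isParametrizedBy_grassmannian S hS).hasDim (fun t ht => ?_)
    ⟨fun t => normalForm K 0 t.2.1 t.2.2, ?_⟩
  · have h1 := rank_jacobian_pluckerSum fun (j : Fin 1) a i => t (j, a, i)
    have h2 := eval_pluckerSum (fun (j : Fin 1) a i => t (j, a, i)) S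
    rw [Fin.sum_univ_one] at h2
    rw [ciSup_unique] at h1
    have h3 : LinearIndependent K fun a i => t (0, a, i) := by
      apply linearIndependent_of_ιMulti_ne_zero
      intro h0
      rw [h0, map_zero] at h2
      exact ht h2
    have h4 := finrank_tangentSpace_le h3
    refine h1.le.trans ?_
    change Module.finrank K (tangentSpace (Submodule.span K (Set.range fun a i => t (0, a, i)))) ≤ _
    omega
  · have h1 := rank_jacobian_pluckerSum fun (_ : Fin 1) => normalForm K 0
    rw [ciSup_unique] at h1
    exact (le_finrank_tangentSpace).trans h1.ge

/-- At a general point the rank of the differential is the dimension of the sum of four tangent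
spaces, which can be computed at the normal form. -/
theorem hasDim_secantVariety :
    HasDim (pluckerBasis K 3 9)
      (secantVariety (pluckerBasis K 3 9) (pluckerGrassmannian K 3 9) 4) 73 := by
  rw [HasDim, secantVariety, homogeneousIdeal_zariskiClosure]
  refine isParametrizedBy_spans.hasDim (fun t ht => ?_)
    ⟨fun t => normalForm K t.1 t.2.1 t.2.2, ?_⟩
  · obtain ⟨g, hg⟩ := exists_linearEquiv_normalForm (v := fun j a i => t (j, a, i)) ht
    refine (rank_jacobian_pluckerSum fun (j : Fin 4) a i => t (j, a, i)).le.trans ?_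
    exact (finrank_sumTangentSpace_map_le K g hg).trans (finrank_sumTangentSpace K).le
  · exact (finrank_sumTangentSpace K).ge.trans (rank_jacobian_pluckerSum (normalForm K)).ge

end Parametrization

end SecantGrassmann

end

theorem mainTheorem5 (K : Type*) [Field K] [IsAlgClosed K] [CharZero K] :
    -- the Grassmannian has dimension 18, so that 75 is the expected dimension in `ℙ⁸³`
    (Module.finrank K (⋀[K]^3 (Fin 9 → K)) = 83 + 1 ∧
      SecantGrassmann.HasDim (SecantGrassmann.pluckerBasis K 3 9)
        (SecantGrassmann.pluckerGrassmannian K 3 9) 18 ∧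
      SecantGrassmann.expectedDim 83 18 4 = 75) ∧
    -- the fourth secant variety has dimension 73 and is 2-defective
    SecantGrassmann.HasDim (SecantGrassmann.pluckerBasis K 3 9)
      (SecantGrassmann.secantVariety (SecantGrassmann.pluckerBasis K 3 9)
        (SecantGrassmann.pluckerGrassmannian K 3 9) 4) 73 ∧
    SecantGrassmann.IsDefective (SecantGrassmann.pluckerBasis K 3 9) 83
      (SecantGrassmann.pluckerGrassmannian K 3 9) 4 2 ∧
    -- `dim W = 10` for the normalized subspaces
    Module.finrank K
      (SecantGrassmann.squaresPart (K := K) (SecantGrassmann.normalForm K) 6) = 10 ∧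
    -- generic subspaces can be normalized and have `dim W = 10`
    ∃ P : MvPolynomial (Fin 4 × Fin 3 × Fin 9) K, P ≠ 0 ∧
      ∀ v : Fin 4 → Fin 3 → Fin 9 → K,
        MvPolynomial.eval (fun t => v t.1 t.2.1 t.2.2) P ≠ 0 →
          (∀ i, LinearIndependent K (v i)) ∧
          (∃ g : (Fin 9 → K) ≃ₗ[K] (Fin 9 → K), ∀ i,
            (Submodule.span K (Set.range (SecantGrassmann.normalForm K i))).map
              (g : (Fin 9 → K) →ₗ[K] (Fin 9 → K)) = Submodule.span K (Set.range (v i))) ∧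
          Module.finrank K (SecantGrassmann.squaresPart (K := K) v 6) = 10 := by
  refine ⟨⟨SecantGrassmann.finrank_exteriorPower K, SecantGrassmann.hasDim_grassmannian K, rfl⟩,
    SecantGrassmann.hasDim_secantVariety K,
    ⟨by norm_num, 18, 73, SecantGrassmann.hasDim_grassmannian K,
      SecantGrassmann.hasDim_secantVariety K, rfl⟩,
    SecantGrassmann.finrank_squaresPart_normalForm K,
    SecantGrassmann.genericPolynomial K, SecantGrassmann.genericPolynomial_ne_zero, ?_⟩
  intro v hv
  obtain ⟨g, hg⟩ := SecantGrassmann.exists_linearEquiv_normalForm hv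
  exact ⟨SecantGrassmann.linearIndependent_of_genericPolynomial hv, ⟨g, hg⟩,
    (SecantGrassmann.finrank_squaresPart_eq g hg 6).trans
      (SecantGrassmann.finrank_squaresPart_normalForm K)⟩
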